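/- Let $\mathcal{G}=(V,\mathcal{E})$ be a finite hypergraph (parallel hyperedges allowed, every hyperedge has at least two vertices), let $h,k$ be positive integers, $K=\{1,\dots,k\}$, and let $\ell,\ell':K\cup\{0\}\to\mathbb{Z}_{>0}$ satisfy $$\sum_{i\in K}\ell'(i)\ \ge\ \ell'(0)\ \ge\ \ell(0)\ \ge\ \sum_{i\in K}\ell(i),\qquad |V|\ \ge\ \ell'(i)\ \ge\ \ell(i)\ \text{ for every } i\in K.$$ Definitions. A digraph $(U,F)$ is an $S$-branching if $S\subseteq U$ and there is a unique directed path from $S$ to every $u\in U$ (so it is a disjoint union of arborescences whose roots are the vertices of $S$). A hyperarc has one head and at least one tail. A directed hypergraph $\mathcal{B}=(U,\mathcal{F})$ is an $S$-hyperbranching if $S\subseteq U$ and each hyperarc can be replaced by an arc from one of its tails to its head so that the resulting arcs form an $S$-branching on the vertex set consisting of $S$ and all heads of hyperarcs in $\mathcal{F}$; this vertex set is the core of $\mathcal{B}$. A hypergraph is an $S$-hyperforest if one can choose a head in each of its hyperedges (the other vertices becoming tails) so that an $S$-hyperbranching is obtained. An $h$-regular packing of $k$ $S_i$-hyperforests in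 $\mathcal{G}$ is a family $B_1,\dots,B_k$ of pairwise hyperedge-disjoint subhypergraphs of $\mathcal{G}$, where $B_i$ is an $S_i$-hyperforest, such that the $B_i$ can be oriented to $S_i$-hyperbranchings for which every vertex of $\mathcal{G}$ belongs to exactly $h$ of the $k$ cores. For a partition $\mathcal{P}$ of $V$ into non-empty classes, $e_{\mathcal{E}}(\mathcal{P})$ is the number of hyperedges that intersect at least two members of $\mathcal{P}$. Then there exist sets $S_1,\dots,S_k\subseteq V$ and an $h$-regular packing of $k$ $S_i$-hyperforests in $\mathcal{G}$ with $$\ell(i)\le |S_i|\le \ell'(i)\ \text{ for every } i\in K,\qquad \ell(0)\le\sum_{i=1}^k|S_i|\le\ell'(0)$$ if and only if $h|V|\ge \ell(0)$ and, for every partition $\mathcal{P}$ of $V$, $$\ell'(0)-\sum_{i\in K}\ell(i)+\sum_{i\in K}\min\{\ell(i),|\mathcal{P}|\}+e_{\mathcal{E}}(\mathcal{P})\ \ge\ h|\mathcal{P}|,$$ $$\sum_{i\in K}\min\{\ell'(i),|\mathcal{P}|\}+e_{\mathcal{E}}(\mathcal{P})\ \ge\ h|\mathcal{P}|.$$ 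-/

import Mathlib

/-- A finite hypergraph with vertices from `V` and hyperedges labelled by elements of `ε`
(parallel hyperedges are allowed). Every hyperedge consists of at least two vertices.
The value of `ends` outside `edges` is irrelevant. -/
structure FinHypergraph (V ε : Type*) where
  verts : Finset V
  edges : Finset ε
  ends : ε → Finset V
  ends_subset : ∀ e ∈ edges, ends e ⊆ verts
  two_le_card : ∀ e ∈ edges, 2 ≤ (ends e).card

/-- A finite directed hypergraph (dypergraph): every hyperarc has exactly one head and at least
one tail. The values of `head` and `tails` outside `arcs` are irrelevant. -/
structure FinDypergraph (V ε : Type*) where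
  verts : Finset V
  arcs : Finset ε
  head : ε → V
  tails : ε → Finset V
  head_mem : ∀ a ∈ arcs, head a ∈ verts
  tails_subset : ∀ a ∈ arcs, tails a ⊆ verts
  tails_nonempty : ∀ a ∈ arcs, (tails a).Nonempty
  head_notMem_tails : ∀ a ∈ arcs, head a ∉ tails a

/-- `IsDipathTo S A tail head v p`: the list `p`, read from its last entry to its first, is the
arc sequence of a directed path that starts in `S`, uses arcs of `A` only, and ends at `v`.
Vertices may be repeated; this makes uniqueness exclude circuits as well. -/
def IsDipathTo {V ε : Type*} (S : Finset V) (A : Finset ε) (tail head : ε → V) :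
    V → List ε → Prop
  | v, [] => v ∈ S
  | v, a :: p => a ∈ A ∧ head a = v ∧ IsDipathTo S A tail head (tail a) p

/-- The digraph with vertex set `U` and arc set `A`, where `a ∈ A` goes from `tail a` to `head a`,
is a branching with root set `S`: there is a unique directed path from `S` to every vertex. -/
def IsBranching {V ε : Type*} (U : Finset V) (A : Finset ε) (tail head : ε → V)
    (S : Finset V) : Prop :=
  S ⊆ U ∧ (∀ a ∈ A, tail a ∈ U ∧ head a ∈ U) ∧
    ∀ v ∈ U, ∃! p : List ε, IsDipathTo S A tail head v p

namespace FinDypergraph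

variable {V ε : Type*} [DecidableEq V]

/-- The vertices of in-degree at least one, together with the vertices of `S`. -/
def core (D : FinDypergraph V ε) (S : Finset V) : Finset V :=
  D.arcs.image D.head ∪ S

/-- `D` is a hyperbranching with root set `S`: every hyperarc can be trimmed to an arc from one of
its tails to its head so that the arcs form an `S`-branching on the core. -/
def IsHyperbranching (D : FinDypergraph V ε) (S : Finset V) : Prop :=
  S ⊆ D.verts ∧ ∃ tail : ε → V, (∀ a ∈ D.arcs, tail a ∈ D.tails a) ∧
    IsBranching (D.core S) D.arcs tail D.head S

end FinDypergraph

namespace FinHypergraph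

variable {V ε : Type*} [DecidableEq V]

/-- `D` is obtained from `G` by choosing in every hyperedge a vertex as its head; the other
vertices of the hyperedge become its tails. -/
def IsOrientation (G : FinHypergraph V ε) (D : FinDypergraph V ε) : Prop :=
  D.verts = G.verts ∧ D.arcs = G.edges ∧
    ∀ e ∈ G.edges, D.head e ∈ G.ends e ∧ D.tails e = (G.ends e).erase (D.head e)

/-- `T` is a hyperforest with root set `S`. -/
def IsHyperforest (T : FinHypergraph V ε) (S : Finset V) : Prop :=
  ∃ D : FinDypergraph V ε, T.IsOrientation D ∧ D.IsHyperbranching S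

/-- `B` is a subhypergraph of `G`. -/
def IsSubhypergraph (B G : FinHypergraph V ε) : Prop :=
  B.verts ⊆ G.verts ∧ B.edges ⊆ G.edges ∧ ∀ e ∈ B.edges, B.ends e = G.ends e

/-- The number of hyperedges of `G` that enter some member of the partition `P` of the vertex set,
where a hyperedge enters `X` if it has a vertex in `X` and a vertex outside `X`. -/
def crossing (G : FinHypergraph V ε) (P : Finpartition G.verts) : ℕ :=
  (G.edges.filter fun e => ∃ X ∈ P.parts, (G.ends e ∩ X).Nonempty ∧ (G.ends e \ X).Nonempty).card

/-- `B 0, …, B (k - 1)` is an `h`-regular packing of `S i`-hyperforests in `G`: the `B i` are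
pairwise hyperedge-disjoint subhypergraphs of `G`, each `B i` is an `S i`-hyperforest, and they
can be oriented to `S i`-hyperbranchings so that every vertex of `G` belongs to exactly `h`
of their cores. -/
structure IsRegularPacking (G : FinHypergraph V ε) (h : ℕ) {k : ℕ}
    (B : Fin k → FinHypergraph V ε) (S : Fin k → Finset V) : Prop where
  sub : ∀ i, (B i).IsSubhypergraph G
  disjoint : ∀ i j, i ≠ j → Disjoint (B i).edges (B j).edges
  hyperforest : ∀ i, (B i).IsHyperforest (S i)
  regular : ∃ D : Fin k → FinDypergraph V ε,
    (∀ i, (B i).IsOrientation (D i) ∧ (D i).IsHyperbranching (S i)) ∧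
    ∀ v ∈ G.verts, (Finset.univ.filter fun i => v ∈ (D i).core (S i)).card = h

end FinHypergraph

/-! Necessity is a count. For a vertex of a class `X` of a partition, each of the `h` cores
containing it either has a root in `X` or has a hyperarc entering `X`. The first alternative occurs
for at most `min |S i| |P|` classes per index `i`; the second uses a crossing hyperedge, which is
used only once because it has a single head and lies in a single `B i`.

For sufficiency the sizes `n i` of the root sets are fixed first (`exists_sizes`): water filling
makes them as equal as the bounds allow, so that both families of partition inequalities combine
into `h |P| ≤ ∑ min (n i) |P| + e(P)`.

Roots are then chosen before any orientation. Given roots `R`, the demand of a set is the number of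
hyperedges inside it plus the number of colours, out of `h`, that it misses. The maximum total
demand of a partition, `maxDemand`, must not exceed the number of hyperedges. Subtracted from a
constant it is a monotone submodular function of `R` (`maxDemand_insert_insert`), so Rado's theorem
produces the roots (`exists_roots`), and its hypothesis reduces to the partition inequality.

Next, a minimal vector dominating the demand has total at most the number of hyperedges, and Hall's
theorem orients the hyperedges with in-degrees below it (`exists_heads`). Every nonempty set is then
entered by as many hyperarcs as it misses colours. Roots are added and moved to get exact sizes and
at most `h` roots per vertex (`exists_exact_roots`). Finally, hyperarcs are exchanged one at a time
for roots at their heads (`exists_replaceable_arc`), until every vertex has `h` roots; undoing the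
exchanges builds the hyperbranchings. -/

/-! ### Tools for supermodular and submodular set functions. -/

/-- A function that is supermodular on intersecting pairs of subsets of `U` is dominated by a
vector whose maximal tight sets form a partition of `U`. -/
theorem exists_tight_vector {V : Type*} [DecidableEq V] (U : Finset V) (q : Finset V → ℤ)
    (hq : ∀ X ⊆ U, ∀ Y ⊆ U, (X ∩ Y).Nonempty → q X + q Y ≤ q (X ∪ Y) + q (X ∩ Y)) :
    ∃ (m : V → ℤ) (P : Finpartition U),
      (∀ X ⊆ U, X.Nonempty → q X ≤ ∑ v ∈ X, m v) ∧
      (∀ X ∈ P.parts, ∑ v ∈ X, m v = q X) ∧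
      ∀ X ⊆ U, X.Nonempty → ∑ v ∈ X, m v = q X → ∃ Y ∈ P.parts, X ⊆ Y := by
  classical
  let valid : (V → ℤ) → Prop := fun m => ∀ X ⊆ U, X.Nonempty → q X ≤ ∑ v ∈ X, m v
  -- A dominating vector is at least `q {v}` at every `v`, so its total over `U` is bounded below
  -- and a vector of minimal total exists.
  have hex : ∃ n : ℕ, ∃ m, valid m ∧ (∑ v ∈ U, m v - ∑ v ∈ U, q {v}).toNat = n := by
    refine ⟨_, fun _ => ∑ X ∈ U.powerset, |q X|, ?_, rfl⟩
    intro X hX hne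
    have h1 : |q X| ≤ ∑ X ∈ U.powerset, |q X| :=
      Finset.single_le_sum (f := fun X => |q X|) (fun _ _ => abs_nonneg _)
        (Finset.mem_powerset.2 hX)
    have h2 : (1 : ℤ) ≤ X.card := by exact_mod_cast hne.card_pos
    have h3 := le_abs_self (q X)
    have h4 := abs_nonneg (q X)
    rw [Finset.sum_const, nsmul_eq_mul]
    nlinarith
  obtain ⟨m, hm, hmn⟩ := Nat.find_spec hex
  -- At a minimal vector no coordinate can be lowered by one, so each vertex lies in a tight set.
  -- Intersecting tight sets have a tight union, so the maximal ones partition `U`.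
  have hcover : ∀ v ∈ U, ∃ X ⊆ U, v ∈ X ∧ ∑ w ∈ X, m w = q X := by
    intro v hv
    by_contra! hno
    have hsum : ∀ X : Finset V, v ∈ X →
        ∑ w ∈ X, Function.update m v (m v - 1) w = ∑ w ∈ X, m w - 1 := by
      intro X hvX
      rw [Finset.sum_update_of_mem hvX, ← Finset.add_sum_erase X m hvX,
        Finset.sdiff_singleton_eq_erase]
      ring
    have hval : valid (Function.update m v (m v - 1)) := by
      intro X hX hne
      by_cases hvX : v ∈ X
      · rw [hsum X hvX]
        have := hno X hX hvX
        have := hm X hX hne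
        omega
      · rw [Finset.sum_update_of_notMem hvX]
        exact hm X hX hne
    have hlow : ∑ w ∈ U, q {w} ≤ ∑ w ∈ U, Function.update m v (m v - 1) w := by
      refine Finset.sum_le_sum fun w hw => ?_
      have := hval {w} (by simpa using hw) (by simp)
      simpa only [Finset.sum_singleton] using this
    rw [hsum U hv] at hlow
    refine Nat.find_min hex (m := (∑ w ∈ U, m w - 1 - ∑ w ∈ U, q {w}).toNat) ?_
      ⟨_, hval, by rw [hsum U hv]⟩
    rw [← hmn]
    omega
  have hunion : ∀ X ⊆ U, ∀ Y ⊆ U, (X ∩ Y).Nonempty → ∑ w ∈ X, m w = q X →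
      ∑ w ∈ Y, m w = q Y → ∑ w ∈ X ∪ Y, m w = q (X ∪ Y) := by
    intro X hX Y hY hne h1 h2
    have h3 := hq X hX Y hY hne
    have h4 := hm (X ∩ Y) (Finset.inter_subset_left.trans hX) hne
    have h5 := hm (X ∪ Y) (Finset.union_subset hX hY)
      (hne.mono (Finset.inter_subset_left.trans Finset.subset_union_left))
    have h6 := Finset.sum_union_inter (s₁ := X) (s₂ := Y) (f := m)
    omega
  -- a maximal tight set above a tight set
  have hmax : ∀ v ∈ U, ∃ X ⊆ U, v ∈ X ∧ ∑ w ∈ X, m w = q X ∧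
      ∀ Y ⊆ U, (X ∩ Y).Nonempty → ∑ w ∈ Y, m w = q Y → Y ⊆ X := by
    intro v hv
    have hne : (U.powerset.filter fun X => v ∈ X ∧ ∑ w ∈ X, m w = q X).Nonempty := by
      obtain ⟨X, hX, h⟩ := hcover v hv
      exact ⟨X, by simpa using ⟨hX, h⟩⟩
    obtain ⟨X, hX, hXmax⟩ := Finset.exists_max_image _ Finset.card hne
    simp only [Finset.mem_filter, Finset.mem_powerset] at hX hXmax
    refine ⟨X, hX.1, hX.2.1, hX.2.2, fun Y hY hXY hYt => ?_⟩
    have h1 := hXmax (X ∪ Y) ⟨Finset.union_subset hX.1 hY, Finset.mem_union_left _ hX.2.1,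
      hunion X hX.1 Y hY hXY hX.2.2 hYt⟩
    have h2 := Finset.eq_of_subset_of_card_le (Finset.subset_union_left (s₁ := X) (s₂ := Y)) h1
    rw [h2]
    exact Finset.subset_union_right
  let parts : Finset (Finset V) := U.powerset.filter fun X => X.Nonempty ∧
    ∑ w ∈ X, m w = q X ∧ ∀ Y ⊆ U, (X ∩ Y).Nonempty → ∑ w ∈ Y, m w = q Y → Y ⊆ X
  have hparts : ∀ X, X ∈ parts ↔ X ⊆ U ∧ X.Nonempty ∧
    ∑ w ∈ X, m w = q X ∧ ∀ Y ⊆ U, (X ∩ Y).Nonempty → ∑ w ∈ Y, m w = q Y → Y ⊆ X := by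
    intro X
    simp [parts]
  have hsame : ∀ X ∈ parts, ∀ Y ∈ parts, (X ∩ Y).Nonempty → X = Y := by
    intro X hX Y hY hne
    rw [hparts] at hX hY
    exact (hY.2.2.2 X hX.1 (by rwa [Finset.inter_comm]) hX.2.2.1).antisymm
      (hX.2.2.2 Y hY.1 hne hY.2.2.1)
  let P : Finpartition U :=
    { parts := parts
      supIndep := by
        rw [Finset.supIndep_iff_pairwiseDisjoint]
        intro X hX Y hY hXY
        change Disjoint X Y
        rw [Finset.disjoint_iff_inter_eq_empty, ← Finset.not_nonempty_iff_eq_empty]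
        exact fun hne => hXY (hsame X hX Y hY hne)
      sup_parts := by
        ext v
        simp only [Finset.mem_sup, id]
        constructor
        · rintro ⟨X, hX, hv⟩
          exact ((hparts X).1 hX).1 hv
        · intro hv
          obtain ⟨X, h1, h2, h3, h4⟩ := hmax v hv
          exact ⟨X, (hparts X).2 ⟨h1, ⟨v, h2⟩, h3, h4⟩, h2⟩
      bot_notMem := by
        intro hbot
        exact Finset.not_nonempty_empty ((hparts _).1 hbot).2.1 }
  refine ⟨m, P, hm, fun X hX => ((hparts X).1 hX).2.2.1, ?_⟩
  rintro X hX ⟨v, hv⟩ ht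
  obtain ⟨Y, h1, h2, h3, h4⟩ := hmax v (hX hv)
  exact ⟨Y, (hparts Y).2 ⟨h1, ⟨v, h2⟩, h3, h4⟩, h4 X hX ⟨v, by simp [h2, hv]⟩ ht⟩

/-- Diminishing returns for pairs of elements imply submodularity. -/
theorem submodular_of_local {N : Type*} [DecidableEq N] (f : Finset N → ℤ)
    (hf : ∀ R a b, f R + f (insert a (insert b R)) ≤ f (insert a R) + f (insert b R))
    (A B : Finset N) : f (A ∪ B) + f (A ∩ B) ≤ f A + f B := by
  -- The marginal value of `a` does not grow as elements of `T` are added one by one.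
  have hmarg : ∀ (a : N) (R T : Finset N),
      f (insert a (T ∪ R)) + f R ≤ f (T ∪ R) + f (insert a R) := by
    intro a R T
    induction T using Finset.induction_on with
    | empty => simp [add_comm]
    | insert b T _ ih =>
      have := hf (T ∪ R) a b
      rw [Finset.insert_union]
      linarith
  have hgen : ∀ C T : Finset N, C ⊆ A → f (A ∪ T) + f C ≤ f A + f (C ∪ T) := by
    intro C T hC
    induction T using Finset.induction_on with
    | empty => simp
    | insert b T _ ih =>
      have h1 := hmarg b (C ∪ T) A
      have h2 : A ∪ (C ∪ T) = A ∪ T := by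
        rw [← Finset.union_assoc, Finset.union_eq_left.2 hC]
      rw [h2] at h1
      rw [Finset.union_insert, Finset.union_insert]
      linarith
  have h1 := hgen (A ∩ B) B Finset.inter_subset_left
  have h2 : A ∩ B ∪ B = B := Finset.union_eq_right.2 Finset.inter_subset_right
  rw [h2] at h1
  linarith

/-- Rado's theorem for a monotone submodular function. -/
theorem exists_transversal_of_submodular {ι N : Type*} [Fintype ι] [DecidableEq ι] [DecidableEq N]
    (f : Finset N → ℤ) (hmono : ∀ A B, A ⊆ B → f A ≤ f B)
    (hsub : ∀ A B, f (A ∪ B) + f (A ∩ B) ≤ f A + f B) (A : ι → Finset N)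
    (hne : ∀ i, (A i).Nonempty) (hA : ∀ J : Finset ι, (J.card : ℤ) ≤ f (J.biUnion A)) :
    ∃ x : ι → N, (∀ i, x i ∈ A i) ∧ ∀ J : Finset ι, (J.card : ℤ) ≤ f (J.image x) := by
  induction hn : ∑ i, (A i).card using Nat.strong_induction_on generalizing A with
  | _ n ih =>
  by_cases hone : ∀ i, (A i).card = 1
  · choose x hx using fun i => Finset.card_eq_one.1 (hone i)
    refine ⟨x, fun i => by simp [hx i], fun J => ?_⟩
    have : J.biUnion A = J.image x := by
      ext y; simp [hx, eq_comm]
    rw [← this]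
    exact hA J
  · push Not at hone
    obtain ⟨i, hi⟩ := hone
    have hi2 : 1 < (A i).card := by
      have := (hne i).card_pos
      omega
    obtain ⟨x, hx, y, hy, hxy⟩ := Finset.one_lt_card.1 hi2
    -- deleting `z` from `A i`
    let A' : N → ι → Finset N := fun z => Function.update A i ((A i).erase z)
    have hstep : ∀ z ∈ A i, (∀ J : Finset ι, (J.card : ℤ) ≤ f (J.biUnion (A' z))) →
        ∃ x : ι → N, (∀ i, x i ∈ A i) ∧ ∀ J : Finset ι, (J.card : ℤ) ≤ f (J.image x) := by
      intro z hz hJ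
      have hsubset : ∀ j, A' z j ⊆ A j := by
        intro j
        by_cases hj : j = i
        · subst hj; simp [A', Finset.erase_subset]
        · simp [A', hj]
      obtain ⟨x, h1, h2⟩ := ih (∑ j, (A' z j).card) (by
        rw [← hn]
        refine Finset.sum_lt_sum (fun j _ => Finset.card_le_card (hsubset j)) ⟨i, Finset.mem_univ _, ?_⟩
        simp only [A', Function.update_self]
        exact Finset.card_erase_lt_of_mem hz) (A' z) (by
        intro j
        by_cases hj : j = i
        · subst hj
          simp only [A', Function.update_self]
          rw [← Finset.card_pos, Finset.card_erase_of_mem hz]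
          omega
        · simpa [A', hj] using hne j) hJ rfl
      exact ⟨x, fun j => hsubset j (h1 j), h2⟩
    by_cases hJx : ∀ J : Finset ι, (J.card : ℤ) ≤ f (J.biUnion (A' x))
    · exact hstep x hx hJx
    by_cases hJy : ∀ J : Finset ι, (J.card : ℤ) ≤ f (J.biUnion (A' y))
    · exact hstep y hy hJy
    -- Both violating families contain `i`. Their values sum to at most `|J₁| + |J₂| - 2`, while
    -- submodularity and the hypothesis for `J₁ ∪ J₂` and `(J₁ ∩ J₂) \ {i}` give at least `|J₁| +
    -- |J₂| - 1`.
    exfalso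
    push Not at hJx hJy
    obtain ⟨J₁, h₁⟩ := hJx
    obtain ⟨J₂, h₂⟩ := hJy
    have hiJ : ∀ z, ∀ J : Finset ι, f (J.biUnion (A' z)) < J.card → i ∈ J := by
      intro z J hJ
      by_contra hiJ
      have : J.biUnion (A' z) = J.biUnion A := by
        refine Finset.biUnion_congr rfl fun j hj => ?_
        have : j ≠ i := fun h => hiJ (h ▸ hj)
        simp [A', this]
      rw [this] at hJ
      exact absurd (hA J) (not_le.2 hJ)
    have hi₁ := hiJ x J₁ h₁
    have hi₂ := hiJ y J₂ h₂
    have hun : (J₁ ∪ J₂).biUnion A ⊆ J₁.biUnion (A' x) ∪ J₂.biUnion (A' y) := by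
      intro z hz
      obtain ⟨j, hj, hzj⟩ := Finset.mem_biUnion.1 hz
      rw [Finset.mem_union]
      by_cases hji : j = i
      · subst hji
        by_cases hzx : z = x
        · right
          exact Finset.mem_biUnion.2 ⟨j, hi₂, by simp [A', hzx, hxy, hx]⟩
        · left
          exact Finset.mem_biUnion.2 ⟨j, hi₁, by simp [A', hzx, hzj]⟩
      · rcases Finset.mem_union.1 hj with hj | hj
        · exact Or.inl (Finset.mem_biUnion.2 ⟨j, hj, by simpa [A', hji] using hzj⟩)
        · exact Or.inr (Finset.mem_biUnion.2 ⟨j, hj, by simpa [A', hji] using hzj⟩)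
    have hin : ((J₁ ∩ J₂).erase i).biUnion A ⊆ J₁.biUnion (A' x) ∩ J₂.biUnion (A' y) := by
      intro z hz
      obtain ⟨j, hj, hzj⟩ := Finset.mem_biUnion.1 hz
      rw [Finset.mem_erase, Finset.mem_inter] at hj
      rw [Finset.mem_inter]
      exact ⟨Finset.mem_biUnion.2 ⟨j, hj.2.1, by simpa [A', hj.1] using hzj⟩,
        Finset.mem_biUnion.2 ⟨j, hj.2.2, by simpa [A', hj.1] using hzj⟩⟩
    have e1 := hmono _ _ hun
    have e2 := hmono _ _ hin
    have e3 := hsub (J₁.biUnion (A' x)) (J₂.biUnion (A' y))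
    have e4 := hA (J₁ ∪ J₂)
    have e5 := hA ((J₁ ∩ J₂).erase i)
    have e6 := Finset.card_union_add_card_inter J₁ J₂
    have e7 := Finset.card_erase_add_one (Finset.mem_inter.2 ⟨hi₁, hi₂⟩)
    omega

/-! ### Root colours, demand, and the maximum demand of a partition. -/

/-- The colours of the roots lying in `X`, where `(i, v) ∈ R` means that `v` is a root of
colour `i`. -/
def rootColours {K V : Type*} [Fintype K] [DecidableEq K] [DecidableEq V]
    (R : Finset (K × V)) (X : Finset V) : Finset K :=
  Finset.univ.filter fun i => ∃ v ∈ X, (i, v) ∈ R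

section RootColours

variable {K V : Type*} [Fintype K] [DecidableEq K] [DecidableEq V]

theorem mem_rootColours {R : Finset (K × V)} {X : Finset V} {i : K} :
    i ∈ rootColours R X ↔ ∃ v ∈ X, (i, v) ∈ R := by
  simp [rootColours]

theorem mem_rootColours_singleton {R : Finset (K × V)} {v : V} {i : K} :
    i ∈ rootColours R {v} ↔ (i, v) ∈ R := by
  simp [rootColours]

theorem rootColours_mono {R R' : Finset (K × V)} {X Y : Finset V} (hR : R ⊆ R') (hX : X ⊆ Y) :
    rootColours R X ⊆ rootColours R' Y := by
  intro i hi
  obtain ⟨v, hv, h⟩ := mem_rootColours.1 hi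
  exact mem_rootColours.2 ⟨v, hX hv, hR h⟩

theorem rootColours_union (R : Finset (K × V)) (X Y : Finset V) :
    rootColours R (X ∪ Y) = rootColours R X ∪ rootColours R Y := by
  ext i
  simp only [mem_rootColours, Finset.mem_union, or_and_right, exists_or]

theorem rootColours_inter_subset (R : Finset (K × V)) (X Y : Finset V) :
    rootColours R (X ∩ Y) ⊆ rootColours R X ∩ rootColours R Y :=
  Finset.subset_inter (rootColours_mono subset_rfl Finset.inter_subset_left)
    (rootColours_mono subset_rfl Finset.inter_subset_right)

theorem rootColours_insert_of_notMem (R : Finset (K × V)) (i : K) {v : V} {X : Finset V}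
    (hv : v ∉ X) : rootColours (insert (i, v) R) X = rootColours R X := by
  ext j
  simp only [mem_rootColours, Finset.mem_insert, Prod.mk.injEq]
  constructor
  · rintro ⟨w, hw, ⟨-, rfl⟩ | h⟩
    · exact absurd hw hv
    · exact ⟨w, hw, h⟩
  · rintro ⟨w, hw, h⟩
    exact ⟨w, hw, Or.inr h⟩

theorem rootColours_insert_of_mem (R : Finset (K × V)) (i : K) {v : V} {X : Finset V}
    (hv : v ∈ X) : rootColours (insert (i, v) R) X = insert i (rootColours R X) := by
  ext j
  simp only [mem_rootColours, Finset.mem_insert, Prod.mk.injEq]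
  constructor
  · rintro ⟨w, hw, ⟨rfl, -⟩ | h⟩
    · exact Or.inl rfl
    · exact Or.inr ⟨w, hw, h⟩
  · rintro (rfl | ⟨w, hw, h⟩)
    · exact ⟨v, hv, Or.inl ⟨rfl, rfl⟩⟩
    · exact ⟨w, hw, Or.inr h⟩

end RootColours

namespace FinHypergraph

variable {K V ε : Type*} [Fintype K] [DecidableEq K] [DecidableEq V]

/-- The number of hyperedges contained in `X`. -/
def innerCount (G : FinHypergraph V ε) (X : Finset V) : ℕ :=
  (G.edges.filter fun e => G.ends e ⊆ X).card

theorem innerCount_supermodular (G : FinHypergraph V ε) (X Y : Finset V) :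
    G.innerCount X + G.innerCount Y ≤ G.innerCount (X ∪ Y) + G.innerCount (X ∩ Y) := by
  classical
  unfold innerCount
  rw [← Finset.card_union_add_card_inter]
  refine add_le_add (Finset.card_le_card ?_) (Finset.card_le_card ?_)
  · intro e
    simp only [Finset.mem_union, Finset.mem_filter]
    rintro (h | h)
    · exact ⟨h.1, h.2.trans Finset.subset_union_left⟩
    · exact ⟨h.1, h.2.trans Finset.subset_union_right⟩
  · intro e
    simp only [Finset.mem_inter, Finset.mem_filter]
    exact fun h => ⟨h.1.1, Finset.subset_inter h.1.2 h.2.2⟩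

theorem card_edges_eq (G : FinHypergraph V ε) (P : Finpartition G.verts) :
    G.edges.card = G.crossing P + ∑ X ∈ P.parts, G.innerCount X := by
  classical
  have h1 : ∑ X ∈ P.parts, G.innerCount X =
      (P.parts.biUnion fun X => G.edges.filter fun e => G.ends e ⊆ X).card := by
    rw [Finset.card_biUnion]
    · rfl
    · intro X hX Y hY hXY
      refine Finset.disjoint_left.2 fun e he he' => ?_
      rw [Finset.mem_filter] at he he'
      have := G.two_le_card e he.1
      obtain ⟨v, hv⟩ : (G.ends e).Nonempty := Finset.card_pos.1 (by omega)
      exact hXY (P.eq_of_mem_parts hX hY (he.2 hv) (he'.2 hv))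
  rw [h1, crossing, ← Finset.card_union_of_disjoint]
  · congr 1
    ext e
    simp only [Finset.mem_union, Finset.mem_filter, Finset.mem_biUnion]
    constructor
    · intro he
      have := G.two_le_card e he
      obtain ⟨v, hv⟩ : (G.ends e).Nonempty := Finset.card_pos.1 (by omega)
      obtain ⟨X, hX, hvX⟩ := P.exists_mem (G.ends_subset e he hv)
      by_cases hsub : G.ends e ⊆ X
      · exact Or.inr ⟨X, hX, he, hsub⟩
      · exact Or.inl ⟨he, X, hX, ⟨v, Finset.mem_inter.2 ⟨hv, hvX⟩⟩,
          Finset.sdiff_nonempty.2 hsub⟩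
    · rintro (h | ⟨X, -, h⟩)
      · exact h.1
      · exact h.1
  · rw [Finset.disjoint_left]
    intro e he he'
    simp only [Finset.mem_filter, Finset.mem_biUnion] at he he'
    obtain ⟨-, X, hX, ⟨v, hv⟩, hne⟩ := he
    obtain ⟨Y, hY, -, hsub⟩ := he'
    rw [Finset.mem_inter] at hv
    have : X = Y := P.eq_of_mem_parts hX hY hv.2 (hsub hv.1)
    subst this
    exact (Finset.sdiff_nonempty.1 hne) hsub

/-- The number of hyperedges in `X`, plus the number of colours still missing in `X`. -/
def demand (G : FinHypergraph V ε) (h : ℕ) (R : Finset (K × V)) (X : Finset V) : ℤ :=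
  h - (min h (rootColours R X).card : ℕ) + G.innerCount X

variable (G : FinHypergraph V ε) (h : ℕ)

/-- The number of colours is monotone and submodular in the set, and truncating such a function at
`h` keeps it submodular. -/
theorem demand_supermodular (R : Finset (K × V)) (X Y : Finset V) :
    G.demand h R X + G.demand h R Y ≤ G.demand h R (X ∪ Y) + G.demand h R (X ∩ Y) := by
  have h1 := G.innerCount_supermodular X Y
  have h2 := Finset.card_union_add_card_inter (rootColours R X) (rootColours R Y)
  rw [← rootColours_union] at h2
  have h3 := Finset.card_le_card (rootColours_inter_subset R X Y)
  have h4 := Finset.card_le_card (rootColours_mono (subset_refl R)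
    (Finset.subset_union_left (s₁ := X) (s₂ := Y)))
  have h5 := Finset.card_le_card (rootColours_mono (subset_refl R)
    (Finset.subset_union_right (s₁ := X) (s₂ := Y)))
  unfold demand
  omega

theorem demand_anti {R R' : Finset (K × V)} (hR : R ⊆ R') (X : Finset V) :
    G.demand h R' X ≤ G.demand h R X := by
  have := Finset.card_le_card (rootColours_mono hR (subset_refl X))
  unfold demand
  omega

theorem demand_insert_of_notMem (R : Finset (K × V)) (i : K) {v : V} {X : Finset V}
    (hv : v ∉ X) : G.demand h (insert (i, v) R) X = G.demand h R X := by
  unfold demand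
  rw [rootColours_insert_of_notMem R i hv]

theorem demand_insert_eq_iff (R : Finset (K × V)) (i : K) {v : V} {X : Finset V} (hv : v ∈ X) :
    G.demand h (insert (i, v) R) X = G.demand h R X ↔
      i ∈ rootColours R X ∨ h ≤ (rootColours R X).card := by
  unfold demand
  rw [rootColours_insert_of_mem R i hv]
  by_cases hi : i ∈ rootColours R X
  · simp [hi]
  · rw [Finset.card_insert_of_notMem hi]
    simp only [hi, false_or]
    omega

theorem le_demand_insert (R : Finset (K × V)) (a : K × V) (X : Finset V) :
    G.demand h R X - 1 ≤ G.demand h (insert a R) X := by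
  obtain ⟨i, v⟩ := a
  by_cases hv : v ∈ X
  · unfold demand
    rw [rootColours_insert_of_mem R i hv]
    have := Finset.card_insert_le i (rootColours R X)
    omega
  · rw [demand_insert_of_notMem G h R i hv]
    omega

/-- For every root set there is a largest total demand of a partition, with a coarsest partition
attaining it. -/
theorem exists_maxDemand (R : Finset (K × V)) :
    ∃ (D : ℤ) (P : Finpartition G.verts), ∑ X ∈ P.parts, G.demand h R X = D ∧
      ∀ Q : Finpartition G.verts, ∑ X ∈ Q.parts, G.demand h R X ≤ D ∧
        (∑ X ∈ Q.parts, G.demand h R X = D → ∀ X ∈ Q.parts, ∃ Y ∈ P.parts, X ⊆ Y) := by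
  obtain ⟨m, P, h1, h2, h3⟩ := exists_tight_vector G.verts (G.demand h R)
    fun X _ Y _ _ => G.demand_supermodular h R X Y
  have hsum : ∀ Q : Finpartition G.verts,
      ∑ X ∈ Q.parts, ∑ v ∈ X, m v = ∑ v ∈ G.verts, m v := by
    intro Q
    have := Finset.sum_biUnion (f := m) (s := Q.parts) (t := id) Q.disjoint
    rw [Q.biUnion_parts] at this
    exact this.symm
  have hle : ∀ Q : Finpartition G.verts, ∀ X ∈ Q.parts, G.demand h R X ≤ ∑ v ∈ X, m v :=
    fun Q X hX => h1 X (Q.le hX) (Q.nonempty_of_mem_parts hX)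
  refine ⟨∑ v ∈ G.verts, m v, P, ?_, fun Q => ⟨?_, fun hQ X hX => ?_⟩⟩
  · rw [← hsum P]
    exact Finset.sum_congr rfl fun X hX => (h2 X hX).symm
  · rw [← hsum Q]
    exact Finset.sum_le_sum (hle Q)
  · rw [← hsum Q, Finset.sum_eq_sum_iff_of_le (hle Q)] at hQ
    exact h3 X (Q.le hX) (Q.nonempty_of_mem_parts hX) (hQ X hX).symm

/-- The largest total demand of a partition. -/
noncomputable def maxDemand (R : Finset (K × V)) : ℤ := (G.exists_maxDemand h R).choose

theorem maxDemand_spec (R : Finset (K × V)) :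
    ∃ P : Finpartition G.verts, ∑ X ∈ P.parts, G.demand h R X = G.maxDemand h R ∧
      ∀ Q : Finpartition G.verts, ∑ X ∈ Q.parts, G.demand h R X = G.maxDemand h R →
        ∀ X ∈ Q.parts, ∃ Y ∈ P.parts, X ⊆ Y := by
  obtain ⟨P, h1, h2⟩ := (G.exists_maxDemand h R).choose_spec
  exact ⟨P, h1, fun Q => (h2 Q).2⟩

theorem sum_demand_le (R : Finset (K × V)) (Q : Finpartition G.verts) :
    ∑ X ∈ Q.parts, G.demand h R X ≤ G.maxDemand h R := by
  obtain ⟨P, h1, h2⟩ := (G.exists_maxDemand h R).choose_spec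
  exact (h2 Q).1

theorem maxDemand_anti {R R' : Finset (K × V)} (hR : R ⊆ R') :
    G.maxDemand h R' ≤ G.maxDemand h R := by
  obtain ⟨P, hP, -⟩ := G.maxDemand_spec h R'
  rw [← hP]
  exact (Finset.sum_le_sum fun X _ => G.demand_anti h hR X).trans (G.sum_demand_le h R P)

theorem le_maxDemand_insert (R : Finset (K × V)) (a : K × V) :
    G.maxDemand h R - 1 ≤ G.maxDemand h (insert a R) := by
  obtain ⟨i, v⟩ := a
  obtain ⟨P, hP, -⟩ := G.maxDemand_spec h R
  refine le_trans ?_ (G.sum_demand_le h _ P)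
  rw [← hP]
  by_cases hv : v ∈ G.verts
  · obtain ⟨X, hX, hvX⟩ := P.exists_mem hv
    rw [← Finset.add_sum_erase _ _ hX, ← Finset.add_sum_erase _ _ hX]
    have h1 := G.le_demand_insert h R (i, v) X
    have h2 : ∑ Y ∈ P.parts.erase X, G.demand h (insert (i, v) R) Y =
        ∑ Y ∈ P.parts.erase X, G.demand h R Y := by
      refine Finset.sum_congr rfl fun Y hY => demand_insert_of_notMem G h R i fun hvY => ?_
      rw [Finset.mem_erase] at hY
      exact hY.1 (P.eq_of_mem_parts hY.2 hX hvY hvX)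
    omega
  · have h2 : ∑ Y ∈ P.parts, G.demand h (insert (i, v) R) Y =
        ∑ Y ∈ P.parts, G.demand h R Y :=
      Finset.sum_congr rfl fun Y hY =>
        demand_insert_of_notMem G h R i fun hvY => hv (P.le hY hvY)
    omega

/-- If a new root does not change the largest demand, then it changes the demand of no class of
the coarsest optimal partition. -/
theorem saturated_of_maxDemand_insert_eq {R : Finset (K × V)} {i : K} {v : V}
    (heq : G.maxDemand h (insert (i, v) R) = G.maxDemand h R) (P : Finpartition G.verts)
    (hP : ∀ Q : Finpartition G.verts, ∑ X ∈ Q.parts, G.demand h R X = G.maxDemand h R →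
      ∀ X ∈ Q.parts, ∃ Y ∈ P.parts, X ⊆ Y)
    {X : Finset V} (hX : X ∈ P.parts) (hv : v ∈ X) :
    i ∈ rootColours R X ∨ h ≤ (rootColours R X).card := by
  obtain ⟨Q, hQ, -⟩ := G.maxDemand_spec h (insert (i, v) R)
  have hle : ∀ Y ∈ Q.parts, G.demand h (insert (i, v) R) Y ≤ G.demand h R Y :=
    fun Y _ => G.demand_anti h (Finset.subset_insert _ _) Y
  -- A partition optimal after the insertion is already optimal before it, with the demand of each
  -- class unchanged. Its class at `v` is thus saturated, and saturation passes to the larger class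
  -- of `P`.
  have hsum : ∑ Y ∈ Q.parts, G.demand h R Y = G.maxDemand h R :=
    (G.sum_demand_le h R Q).antisymm (by rw [← heq, ← hQ]; exact Finset.sum_le_sum hle)
  have hall := (Finset.sum_eq_sum_iff_of_le hle).1 (by rw [hQ, hsum, heq])
  obtain ⟨Y, hY, hvY⟩ := Q.exists_mem (P.le hX hv)
  obtain ⟨Z, hZ, hYZ⟩ := hP Q hsum Y hY
  obtain rfl : Z = X := P.eq_of_mem_parts hZ hX (hYZ hvY) hv
  have hmono := rootColours_mono (subset_refl R) hYZ
  rcases (G.demand_insert_eq_iff h R i hvY).1 (hall Y hY) with hi | hi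
  · exact Or.inl (hmono hi)
  · exact Or.inr (hi.trans (Finset.card_le_card hmono))

/-- This is the local submodularity needed for Rado's theorem. One root lowers the maximum by at
most one, so only the case where neither `a` nor `b` lowers it matters. Then the coarsest optimal
partition is saturated for both, and together they still leave its total demand unchanged. -/
theorem maxDemand_insert_insert (R : Finset (K × V)) (a b : K × V) :
    G.maxDemand h (insert a R) + G.maxDemand h (insert b R) ≤
      G.maxDemand h R + G.maxDemand h (insert a (insert b R)) := by
  have ha := G.le_maxDemand_insert h R a
  have hb := G.le_maxDemand_insert h R b
  have hab := G.le_maxDemand_insert h (insert b R) a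
  have hba := G.le_maxDemand_insert h (insert a R) b
  rw [Finset.insert_comm] at hba
  have ha' := G.maxDemand_anti h (Finset.subset_insert a R)
  have hb' := G.maxDemand_anti h (Finset.subset_insert b R)
  by_cases heq : G.maxDemand h (insert a R) = G.maxDemand h R ∧
      G.maxDemand h (insert b R) = G.maxDemand h R
  swap
  · omega
  obtain ⟨i, v⟩ := a
  obtain ⟨j, w⟩ := b
  obtain ⟨P, hP, hPmax⟩ := G.maxDemand_spec h R
  have hsum := G.sum_demand_le h (insert (i, v) (insert (j, w) R)) P
  have hsame : ∑ X ∈ P.parts, G.demand h (insert (i, v) (insert (j, w) R)) X =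
      ∑ X ∈ P.parts, G.demand h R X := by
    refine Finset.sum_congr rfl fun X hX => ?_
    have hw : G.demand h (insert (j, w) R) X = G.demand h R X := by
      by_cases hwX : w ∈ X
      · exact (G.demand_insert_eq_iff h R j hwX).2
          (G.saturated_of_maxDemand_insert_eq h heq.2 P hPmax hX hwX)
      · exact G.demand_insert_of_notMem h R j hwX
    rw [← hw]
    by_cases hvX : v ∈ X
    · rw [G.demand_insert_eq_iff h _ i hvX]
      have hmono := rootColours_mono (Finset.subset_insert (j, w) R) (subset_refl X)
      rcases G.saturated_of_maxDemand_insert_eq h heq.1 P hPmax hX hvX with hi | hi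
      · exact Or.inl (hmono hi)
      · exact Or.inr (hi.trans (Finset.card_le_card hmono))
    · exact G.demand_insert_of_notMem h _ i hvX
  omega

/-! ### Choice of the roots. -/

/-- Root sets of bounded sizes with which no partition demands more than all hyperedges. -/
theorem exists_roots (hne : G.verts.Nonempty) (n : K → ℕ)
    (hP : ∀ P : Finpartition G.verts,
      h * P.parts.card ≤ ∑ i, min (n i) P.parts.card + G.crossing P) :
    ∃ R : Finset (K × V), (∀ i v, (i, v) ∈ R → v ∈ G.verts) ∧
      (∀ i, (R.filter fun a => a.1 = i).card ≤ n i) ∧ G.maxDemand h R ≤ G.edges.card := by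
  let f : Finset (K × V) → ℤ := fun R => ∑ i, (n i : ℤ) + G.edges.card - G.maxDemand h R
  -- Colour `i` has `n i` slots, each free to pick any vertex; slots may coincide, so only upper
  -- bounds on the sizes result. The constant in `f` makes the Rado condition for all slots read
  -- `maxDemand ≤ |E|`.
  obtain ⟨x, hx, hxJ⟩ := exists_transversal_of_submodular (ι := Σ i, Fin (n i)) f
    (fun A B hAB => by have := G.maxDemand_anti h hAB; simp only [f]; omega)
    (submodular_of_local f fun R a b => by
      have := G.maxDemand_insert_insert h R a b; simp only [f]; omega)
    (fun j => {j.1} ×ˢ G.verts) (fun j => by simpa using hne) (by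
      intro J
      let I : Finset K := J.image Sigma.fst
      have hJI : J.card ≤ ∑ i ∈ I, n i := by
        have : J ⊆ I.sigma fun i => (Finset.univ : Finset (Fin (n i))) := by
          intro j hj
          simp only [Finset.mem_sigma, Finset.mem_univ, and_true]
          exact Finset.mem_image_of_mem _ hj
        simpa using Finset.card_le_card this
      have hU : J.biUnion (fun j => ({j.1} : Finset K) ×ˢ G.verts) = I ×ˢ G.verts := by
        ext ⟨i, v⟩
        simp only [Finset.mem_biUnion, Finset.mem_product, Finset.mem_singleton, I,
          Finset.mem_image]
        constructor
        · rintro ⟨j, hj, rfl, hv⟩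
          exact ⟨⟨j, hj, rfl⟩, hv⟩
        · rintro ⟨⟨j, hj, rfl⟩, hv⟩
          exact ⟨j, hj, rfl, hv⟩
      rw [hU]
      obtain ⟨P, hPD, -⟩ := G.maxDemand_spec h (I ×ˢ G.verts)
      -- When all vertices are roots of exactly the colours in `I`, each class sees exactly these
      -- colours.
      have hdem : ∀ X ∈ P.parts, G.demand h (I ×ˢ G.verts) X =
          (h - (min h I.card : ℕ) : ℤ) + G.innerCount X := by
        intro X hX
        have : rootColours (I ×ˢ G.verts) X = I := by
          ext i
          obtain ⟨v, hv⟩ := P.nonempty_of_mem_parts hX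
          simp only [mem_rootColours, Finset.mem_product]
          exact ⟨fun ⟨_, _, hi, _⟩ => hi, fun hi => ⟨v, hv, hi, P.le hX hv⟩⟩
        rw [demand, this]
      rw [Finset.sum_congr rfl hdem, Finset.sum_add_distrib, Finset.sum_const,
        nsmul_eq_mul] at hPD
      have hE := G.card_edges_eq P
      have hcond := hP P
      have hmin : ∑ i, min (n i) P.parts.card ≤ I.card * P.parts.card + ∑ i ∈ Iᶜ, n i := by
        rw [← Finset.sum_add_sum_compl I]
        refine add_le_add ?_ (Finset.sum_le_sum fun i _ => min_le_left _ _)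
        rw [← smul_eq_mul]
        exact Finset.sum_le_card_nsmul _ _ _ fun i _ => min_le_right _ _
      have hsplit := Finset.sum_add_sum_compl I n
      have hE' : (G.edges.card : ℤ) = G.crossing P + ∑ X ∈ P.parts, (G.innerCount X : ℤ) := by
        exact_mod_cast hE
      have hmain : (P.parts.card : ℤ) * (h - (min h I.card : ℕ)) ≤
          G.crossing P + (∑ i ∈ Iᶜ, n i : ℕ) := by
        rcases le_total h I.card with hle | hle
        · rw [min_eq_left hle, sub_self, mul_zero]
          positivity
        · rw [min_eq_right hle]
          have : (h * P.parts.card : ℤ) ≤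
              I.card * P.parts.card + (∑ i ∈ Iᶜ, n i : ℕ) + G.crossing P := by
            exact_mod_cast hcond.trans (Nat.add_le_add_right hmin _)
          linarith
      simp only [f]
      have hsplit' : (∑ i, (n i : ℤ)) = (∑ i ∈ I, n i : ℕ) + (∑ i ∈ Iᶜ, n i : ℕ) := by
        exact_mod_cast hsplit.symm
      have hJI' : (J.card : ℤ) ≤ (∑ i ∈ I, n i : ℕ) := by exact_mod_cast hJI
      rw [← hPD, hsplit', hE']
      linarith)
  refine ⟨Finset.univ.image x, ?_, ?_, ?_⟩
  · intro i v hiv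
    obtain ⟨j, -, hj⟩ := Finset.mem_image.1 hiv
    have := hx j
    rw [hj, Finset.mem_product] at this
    exact this.2
  · intro i
    have hsub : (Finset.univ.image x).filter (fun a => a.1 = i) ⊆
        Finset.univ.image fun t : Fin (n i) => x ⟨i, t⟩ := by
      intro a ha
      rw [Finset.mem_filter] at ha
      obtain ⟨j, -, hj⟩ := Finset.mem_image.1 ha.1
      have h1 := hx j
      rw [Finset.mem_product, Finset.mem_singleton, hj, ha.2] at h1
      obtain ⟨h1, -⟩ := h1
      obtain ⟨j1, t⟩ := j
      dsimp only at h1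
      subst h1
      exact Finset.mem_image.2 ⟨t, Finset.mem_univ _, hj⟩
    refine (Finset.card_le_card hsub).trans (Finset.card_image_le.trans ?_)
    simp
  · have := hxJ Finset.univ
    simp only [f, Finset.card_univ, Fintype.card_sigma, Fintype.card_fin] at this
    push_cast at this
    linarith

end FinHypergraph

/-! ### Orientation of the hyperedges. -/

/-- The number of hyperarcs of `F` that enter `X`, that is, have their head in `X` and a tail
outside `X`. -/
def enterCount {V ε : Type*} [DecidableEq V] (F : Finset ε) (head : ε → V) (tails : ε → Finset V)
    (X : Finset V) : ℕ :=
  (F.filter fun a => head a ∈ X ∧ ¬ tails a ⊆ X).card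

namespace FinHypergraph

variable {K V ε : Type*} [Fintype K] [DecidableEq K] [DecidableEq V]

/-- If no partition demands more than all hyperedges, then the hyperedges can be oriented so that
every set is entered by as many hyperarcs as it misses colours. -/
theorem exists_heads (G : FinHypergraph V ε) (h : ℕ) (R : Finset (K × V))
    (hne : G.verts.Nonempty) (hR : G.maxDemand h R ≤ G.edges.card) :
    ∃ head : ε → V, (∀ e ∈ G.edges, head e ∈ G.ends e) ∧
      ∀ X ⊆ G.verts, X.Nonempty →
        h ≤ enterCount G.edges head (fun e => (G.ends e).erase (head e)) X +
          (rootColours R X).card := by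
  classical
  obtain ⟨m, P, hm, hP, -⟩ := exists_tight_vector G.verts (G.demand h R)
    fun X _ Y _ _ => G.demand_supermodular h R X Y
  have hmU : ∑ v ∈ G.verts, m v ≤ G.edges.card := by
    have h1 := Finset.sum_biUnion (f := m) (s := P.parts) (t := id) P.disjoint
    rw [P.biUnion_parts] at h1
    rw [h1]
    exact (Finset.sum_congr rfl fun X hX => hP X hX).trans_le ((G.sum_demand_le h R P).trans hR)
  have hinner : ∀ X ⊆ G.verts, X.Nonempty → (G.innerCount X : ℤ) ≤ ∑ v ∈ X, m v := by
    intro X hX hne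
    have := hm X hX hne
    unfold demand at this
    omega
  have hm0 : ∀ v ∈ G.verts, 0 ≤ m v := by
    intro v hv
    have := hinner {v} (by simpa using hv) (by simp)
    rw [Finset.sum_singleton] at this
    omega
  have hends : ∀ e ∈ G.edges, (G.ends e).Nonempty := fun e he =>
    Finset.card_pos.1 (by have := G.two_le_card e he; omega)
  -- Each vertex `v` offers `m v` places for heads; Hall's condition holds because `m` dominates
  -- `innerCount`.
  let slots : G.edges → Finset (Σ v : V, Fin (m v).toNat) := fun e =>
    (G.ends e).sigma fun _ => Finset.univ
  have htoNat : ∀ X ⊆ G.verts, ((∑ v ∈ X, (m v).toNat : ℕ) : ℤ) = ∑ v ∈ X, m v := by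
    intro X hX
    rw [Nat.cast_sum]
    exact Finset.sum_congr rfl fun v hv => Int.toNat_of_nonneg (hm0 v (hX hv))
  have hhall : ∀ F : Finset G.edges, F.card ≤ (F.biUnion slots).card := by
    intro F
    rcases F.eq_empty_or_nonempty with rfl | ⟨e₀, he₀⟩
    · simp
    let X : Finset V := F.biUnion fun e => G.ends e
    have hXU : X ⊆ G.verts := by
      intro v hv
      obtain ⟨e, -, hve⟩ := Finset.mem_biUnion.1 hv
      exact G.ends_subset e e.2 hve
    have hXne : X.Nonempty := by
      obtain ⟨v, hv⟩ := hends e₀ e₀.2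
      exact ⟨v, Finset.mem_biUnion.2 ⟨e₀, he₀, hv⟩⟩
    have h1 : F.biUnion slots = X.sigma fun _ => Finset.univ := by
      ext ⟨v, t⟩
      simp [slots, X]
    have h2 : F.card ≤ G.innerCount X := by
      rw [← Finset.card_map (Function.Embedding.subtype _)]
      refine Finset.card_le_card fun e he => ?_
      obtain ⟨e', he', rfl⟩ := Finset.mem_map.1 he
      exact Finset.mem_filter.2 ⟨e'.2, fun v hv => Finset.mem_biUnion.2 ⟨e', he', hv⟩⟩
    have h3 := hinner X hXU hXne
    have h4 := htoNat X hXU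
    rw [h1, Finset.card_sigma]
    simp only [Finset.card_univ, Fintype.card_fin]
    omega
  obtain ⟨g, hginj, hg⟩ := (Finset.all_card_le_biUnion_card_iff_exists_injective slots).1 hhall
  obtain ⟨v₀, -⟩ := hne
  let head : ε → V := fun e => if he : e ∈ G.edges then (g ⟨e, he⟩).1 else v₀
  have hhead : ∀ e (he : e ∈ G.edges), head e = (g ⟨e, he⟩).1 := fun e he => dif_pos he
  have hmem : ∀ e ∈ G.edges, head e ∈ G.ends e := by
    intro e he
    rw [hhead e he]
    exact (Finset.mem_sigma.1 (hg ⟨e, he⟩)).1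
  have hcap : ∀ Y ⊆ G.verts, ((G.edges.filter fun e => head e ∈ Y).card : ℤ) ≤ ∑ v ∈ Y, m v := by
    intro Y hY
    rcases (G.edges.filter fun e => head e ∈ Y).eq_empty_or_nonempty with h0 | ⟨e₀, he₀⟩
    · rw [h0, Finset.card_empty]
      exact Finset.sum_nonneg fun v hv => hm0 v (hY hv)
    replace he₀ := (Finset.mem_filter.1 he₀).1
    rw [← htoNat Y hY]
    have : (Y.sigma fun v => (Finset.univ : Finset (Fin (m v).toNat))).card =
        ∑ v ∈ Y, (m v).toNat := by simp
    rw [← this]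
    norm_cast
    refine Finset.card_le_card_of_injOn
      (fun e => if he : e ∈ G.edges then g ⟨e, he⟩ else g ⟨e₀, he₀⟩) ?_ ?_
    · intro e he
      obtain ⟨he, heY⟩ := Finset.mem_filter.1 he
      rw [hhead e he] at heY
      simpa [he] using heY
    · intro e he e' he' heq
      have he := (Finset.mem_filter.1 he).1
      have he' := (Finset.mem_filter.1 he').1
      simp only [he, he', dif_pos] at heq
      exact congrArg Subtype.val (hginj heq)
  refine ⟨head, hmem, fun X hX hne => ?_⟩
  -- Few heads outside `X` force at least `m(X)` heads inside it. A hyperedge with its head in `X`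
  -- lies in `X` or enters it, so the entering ones number at least `m(X)` minus the inner ones.
  have h1 := hcap (G.verts \ X) Finset.sdiff_subset
  have h2 : (G.edges.filter fun e => head e ∈ X).card +
      (G.edges.filter fun e => head e ∈ G.verts \ X).card = G.edges.card := by
    rw [← Finset.card_filter_add_card_filter_not (s := G.edges) fun e => head e ∈ X]
    congr 2
    refine Finset.filter_congr fun e he => ?_
    simp [G.ends_subset e he (hmem e he)]
  have h3 := Finset.sum_sdiff (f := m) hX
  have h4 : (G.edges.filter fun e => head e ∈ X).card ≤ G.innerCount X +
      enterCount G.edges head (fun e => (G.ends e).erase (head e)) X := by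
    refine (Finset.card_le_card ?_).trans (Finset.card_union_le _ _)
    intro e he
    obtain ⟨he, heX⟩ := Finset.mem_filter.1 he
    rw [Finset.mem_union, Finset.mem_filter, Finset.mem_filter]
    by_cases hsub : G.ends e ⊆ X
    · exact Or.inl ⟨he, hsub⟩
    · refine Or.inr ⟨he, heX, fun hs => hsub ?_⟩
      rw [← Finset.insert_erase (hmem e he)]
      exact Finset.insert_subset heX hs
  have h5 := hm X hX hne
  unfold demand at h5
  have h6 : (∑ v ∈ G.verts \ X, m v) + ∑ v ∈ X, m v ≤ G.edges.card := h3 ▸ hmU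
  omega

end FinHypergraph

/-! ### Prescribed sizes of the root sets and at most `h` roots at every vertex. -/

/-- The roots of colour `i`. -/
def rootSet {K V : Type*} [DecidableEq K] [DecidableEq V] (R : Finset (K × V)) (i : K) :
    Finset V :=
  (R.filter fun a => a.1 = i).image Prod.snd

theorem mem_rootSet {K V : Type*} [DecidableEq K] [DecidableEq V] {R : Finset (K × V)} {i : K}
    {v : V} : v ∈ rootSet R i ↔ (i, v) ∈ R := by
  simp [rootSet]

section ExactRoots

variable {K V : Type*} [Fintype K] [DecidableEq K] [DecidableEq V]

theorem sum_card_rootColours_singleton {U : Finset V} {R : Finset (K × V)}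
    (hU : ∀ i v, (i, v) ∈ R → v ∈ U) :
    ∑ v ∈ U, (rootColours R {v}).card = ∑ i, (rootSet R i).card := by
  have h := Finset.sum_card_bipartiteAbove_eq_sum_card_bipartiteBelow
    (s := U) (t := (Finset.univ : Finset K)) fun v i => (i, v) ∈ R
  have h1 : ∀ v ∈ U, (rootColours R {v}).card =
      (Finset.bipartiteAbove (fun v i => (i, v) ∈ R) (Finset.univ : Finset K) v).card := by
    intro v _
    congr 1
    ext i
    simp [Finset.bipartiteAbove, mem_rootColours_singleton]
  have h2 : ∀ i ∈ (Finset.univ : Finset K), (rootSet R i).card =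
      (Finset.bipartiteBelow (fun v i => (i, v) ∈ R) U i).card := by
    intro i _
    congr 1
    ext v
    simp only [Finset.bipartiteBelow, mem_rootSet, Finset.mem_filter]
    exact ⟨fun h => ⟨hU i v h, h⟩, fun h => h.2⟩
  rw [Finset.sum_congr rfl h1, Finset.sum_congr rfl h2, h]

/-- Roots can be moved away from vertices that have more than `h` of them. -/
theorem exists_balanced_roots {U : Finset V} {h : ℕ} {d : Finset V → ℕ} (R : Finset (K × V))
    (hU : ∀ i v, (i, v) ∈ R → v ∈ U) (hsum : ∑ i, (rootSet R i).card ≤ h * U.card)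
    (hd : ∀ X ⊆ U, X.Nonempty → h ≤ d X + (rootColours R X).card) :
    ∃ R' : Finset (K × V), (∀ i v, (i, v) ∈ R' → v ∈ U) ∧
      (∀ i, (rootSet R' i).card = (rootSet R i).card) ∧
      (∀ X ⊆ U, X.Nonempty → h ≤ d X + (rootColours R' X).card) ∧
      ∀ v ∈ U, (rootColours R' {v}).card ≤ h := by
  induction hn : ∑ v ∈ U, ((rootColours R {v}).card - h) using Nat.strong_induction_on
    generalizing R with
  | _ n ih =>
  by_cases hall : ∀ v ∈ U, (rootColours R {v}).card ≤ h
  · exact ⟨R, hU, fun _ => rfl, hd, hall⟩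
  push Not at hall
  obtain ⟨v, hv, hvh⟩ := hall
  obtain ⟨u, hu, huh⟩ : ∃ u ∈ U, (rootColours R {u}).card < h := by
    by_contra! hge
    have : ∑ _w ∈ U, h < ∑ w ∈ U, (rootColours R {w}).card :=
      Finset.sum_lt_sum hge ⟨v, hv, hvh⟩
    rw [sum_card_rootColours_singleton hU, Finset.sum_const, smul_eq_mul, mul_comm] at this
    omega
  obtain ⟨i, hi, hi'⟩ := Finset.exists_mem_notMem_of_card_lt_card (huh.trans hvh)
  rw [mem_rootColours_singleton] at hi hi'
  have huv : u ≠ v := fun h => hi' (h ▸ hi)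
  -- Moving the root of colour `i` from `v` to `u` is harmless: `v` keeps at least `h` colours, so
  -- sets containing `v` stay covered, and other sets lose nothing. The total excess over `h` drops.
  let R₁ : Finset (K × V) := insert (i, u) (R.erase (i, v))
  have hmem : ∀ j w, (j, w) ∈ R₁ ↔ (j = i ∧ w = u) ∨ (¬ (j = i ∧ w = v) ∧ (j, w) ∈ R) := by
    intro j w
    simp [R₁]
  have hU₁ : ∀ j w, (j, w) ∈ R₁ → w ∈ U := by
    intro j w hjw
    rcases (hmem j w).1 hjw with ⟨-, rfl⟩ | ⟨-, hR⟩
    · exact hu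
    · exact hU j w hR
  have hcard : ∀ j, (rootSet R₁ j).card = (rootSet R j).card := by
    intro j
    by_cases hj : j = i
    · subst hj
      have : rootSet R₁ j = insert u ((rootSet R j).erase v) := by
        ext w
        simp [mem_rootSet, hmem]
      rw [this, Finset.card_insert_of_notMem (by simp [mem_rootSet, hi']),
        Finset.card_erase_add_one (mem_rootSet.2 hi)]
    · congr 1
      ext w
      simp [mem_rootSet, hmem, hj]
  have hother : ∀ X : Finset V, v ∉ X → rootColours R X ⊆ rootColours R₁ X := by
    intro X hvX j hj
    obtain ⟨w, hw, hjw⟩ := mem_rootColours.1 hj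
    exact mem_rootColours.2 ⟨w, hw, (hmem j w).2 (Or.inr ⟨fun h => hvX (h.2 ▸ hw), hjw⟩)⟩
  have hv₁ : rootColours R₁ {v} = (rootColours R {v}).erase i := by
    ext j
    simp [mem_rootColours_singleton, hmem, huv.symm]
  have hd₁ : ∀ X ⊆ U, X.Nonempty → h ≤ d X + (rootColours R₁ X).card := by
    intro X hX hne
    by_cases hvX : v ∈ X
    · have h1 := Finset.card_le_card (rootColours_mono (subset_refl R₁)
        (Finset.singleton_subset_iff.2 hvX))
      rw [hv₁, Finset.card_erase_of_mem (mem_rootColours_singleton.2 hi)] at h1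
      omega
    · have h1 := Finset.card_le_card (hother X hvX)
      have h2 := hd X hX hne
      omega
  have hsum₁ : ∑ j, (rootSet R₁ j).card ≤ h * U.card := by
    rwa [Finset.sum_congr rfl fun j _ => hcard j]
  obtain ⟨R', h1, h2, h3, h4⟩ := ih (∑ w ∈ U, ((rootColours R₁ {w}).card - h)) (by
    rw [← hn]
    refine Finset.sum_lt_sum (fun w hw => ?_) ⟨v, hv, ?_⟩
    · by_cases hwu : w = u
      · subst hwu
        have : rootColours R₁ {w} ⊆ insert i (rootColours R {w}) := by
          intro j
          simp only [mem_rootColours_singleton, hmem, Finset.mem_insert]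
          tauto
        have := (Finset.card_le_card this).trans (Finset.card_insert_le _ _)
        omega
      · have : rootColours R₁ {w} ⊆ rootColours R {w} := by
          intro j
          simp only [mem_rootColours_singleton, hmem]
          tauto
        have := Finset.card_le_card this
        omega
    · rw [hv₁, Finset.card_erase_of_mem (mem_rootColours_singleton.2 hi)]
      omega) R₁ hU₁ hsum₁ hd₁ rfl
  exact ⟨R', h1, fun j => (h2 j).trans (hcard j), h3, h4⟩

/-- Root sets of bounded sizes can be replaced by root sets of prescribed sizes with at most `h`
roots at every vertex. -/
theorem exists_exact_roots {U : Finset V} {h : ℕ} {d : Finset V → ℕ} {n : K → ℕ}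
    (R : Finset (K × V)) (hU : ∀ i v, (i, v) ∈ R → v ∈ U) (hR : ∀ i, (rootSet R i).card ≤ n i)
    (hnU : ∀ i, n i ≤ U.card) (hsum : ∑ i, n i ≤ h * U.card)
    (hd : ∀ X ⊆ U, X.Nonempty → h ≤ d X + (rootColours R X).card) :
    ∃ R' : Finset (K × V), (∀ i v, (i, v) ∈ R' → v ∈ U) ∧
      (∀ i, (rootSet R' i).card = n i) ∧
      (∀ X ⊆ U, X.Nonempty → h ≤ d X + (rootColours R' X).card) ∧
      ∀ v ∈ U, (rootColours R' {v}).card ≤ h := by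
  have hsub : ∀ i, rootSet R i ⊆ U := fun i v hv => hU i v (mem_rootSet.1 hv)
  choose S hRS hSU hSn using fun i =>
    Finset.exists_subsuperset_card_eq (hsub i) (hR i) (hnU i)
  let R₁ : Finset (K × V) := Finset.univ.biUnion fun i => {i} ×ˢ S i
  have hmem : ∀ i v, (i, v) ∈ R₁ ↔ v ∈ S i := by
    intro i v
    simp [R₁]
  have hset : ∀ i, rootSet R₁ i = S i := by
    intro i
    ext v
    rw [mem_rootSet, hmem]
  have hRR₁ : R ⊆ R₁ := by
    rintro ⟨i, v⟩ hiv
    exact (hmem i v).2 (hRS i (mem_rootSet.2 hiv))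
  obtain ⟨R', h1, h2, h3, h4⟩ := exists_balanced_roots (h := h) (d := d) R₁
    (fun i v hiv => hSU i ((hmem i v).1 hiv)) (by simpa only [hset, hSn] using hsum)
    (fun X hX hne => (hd X hX hne).trans
      (Nat.add_le_add_left (Finset.card_le_card (rootColours_mono hRR₁ subset_rfl)) _))
  exact ⟨R', h1, fun i => by rw [h2, hset, hSn], h3, h4⟩

end ExactRoots

/-! ### Packing hyperbranchings with given roots. -/

theorem enterCount_submodular {V ε : Type*} [DecidableEq V] (F : Finset ε) (head : ε → V)
    (tails : ε → Finset V) (X Y : Finset V) :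
    enterCount F head tails (X ∪ Y) + enterCount F head tails (X ∩ Y) ≤
      enterCount F head tails X + enterCount F head tails Y := by
  classical
  unfold enterCount
  simp only [Finset.card_filter, ← Finset.sum_add_distrib]
  refine Finset.sum_le_sum fun a _ => ?_
  have h1 : tails a ⊆ X → tails a ⊆ X ∪ Y := fun h => h.trans Finset.subset_union_left
  have h2 : tails a ⊆ Y → tails a ⊆ X ∪ Y := fun h => h.trans Finset.subset_union_right
  have h3 : tails a ⊆ X ∩ Y ↔ tails a ⊆ X ∧ tails a ⊆ Y := Finset.subset_inter_iff
  by_cases hX : head a ∈ X <;> by_cases hY : head a ∈ Y <;> by_cases tX : tails a ⊆ X <;>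
    by_cases tY : tails a ⊆ Y <;> by_cases tU : tails a ⊆ X ∪ Y <;>
    simp_all

/-- Used when a hyperarc is restored: a path from the temporary root at its head is prolonged
backwards to a genuine root. -/
theorem IsDipathTo.transfer {V ε : Type*} {S S' : Finset V} {A A' : Finset ε}
    {tail tail' head : ε → V} (hA : ∀ b ∈ A', b ∈ A ∧ tail b = tail' b)
    (hS : ∀ s ∈ S', ∃ p, IsDipathTo S A tail head s p) {v : V} {p : List ε}
    (hp : IsDipathTo S' A' tail' head v p) : ∃ p', IsDipathTo S A tail head v p' := by
  induction p generalizing v with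
  | nil => exact hS v hp
  | cons b p ih =>
    obtain ⟨hb, hv, hp⟩ := hp
    obtain ⟨p', hp'⟩ := ih hp
    exact ⟨b :: p', (hA b hb).1, hv, by rwa [(hA b hb).2]⟩

section Packing

variable {K V ε : Type*} [Fintype K] [DecidableEq K] [DecidableEq V]

/-- If some vertex has fewer than `h` roots, then some hyperarc can be replaced by a root at its
head, of a colour present at one of its tails, without violating the covering condition. -/
theorem exists_replaceable_arc [DecidableEq ε] {U : Finset V} {head : ε → V}
    {tails : ε → Finset V} {h : ℕ} {F : Finset ε} {R : Finset (K × V)}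
    (htails : ∀ a ∈ F, tails a ⊆ U)
    (hcov : ∀ X ⊆ U, X.Nonempty → h ≤ enterCount F head tails X + (rootColours R X).card)
    (hlow : ∃ v ∈ U, (rootColours R {v}).card < h) :
    ∃ a ∈ F, ∃ u ∈ tails a, ∃ j, (j, u) ∈ R ∧ (j, head a) ∉ R ∧
      (rootColours R {head a}).card < h ∧
      ∀ Z ⊆ U, Z.Nonempty → h ≤ enterCount (F.erase a) head tails Z +
        (rootColours (insert (j, head a) R) Z).card := by
  obtain ⟨v₀, hv₀, hv₀h⟩ := hlow
  let d := enterCount F head tails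
  let s : Finset V → ℕ := fun X => (rootColours R X).card
  have hcov : ∀ X ⊆ U, X.Nonempty → h ≤ d X + s X := hcov
  have smono : ∀ {X Y : Finset V}, X ⊆ Y → s X ≤ s Y := fun hXY =>
    Finset.card_le_card (rootColours_mono subset_rfl hXY)
  -- Tight sets containing a vertex that sees fewer colours than the set, counted up to `h`. The
  -- whole of `U` is one of them, and `X` is a minimal one.
  let fam : Finset (Finset V) := U.powerset.filter fun X =>
    d X + min h (s X) = h ∧ ∃ v ∈ X, s {v} < min h (s X)
  have hfam : ∀ X, X ∈ fam ↔ X ⊆ U ∧ d X + min h (s X) = h ∧ ∃ v ∈ X, s {v} < min h (s X) := by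
    intro X
    simp [fam]
  have hUfam : U ∈ fam := by
    have hdU : d U = 0 := by
      simp only [d, enterCount, Finset.card_eq_zero]
      exact Finset.filter_false_of_mem fun a ha h => h.2 (htails a ha)
    have := hcov U subset_rfl ⟨v₀, hv₀⟩
    refine (hfam U).2 ⟨subset_rfl, by omega, v₀, hv₀, ?_⟩
    change s {v₀} < h at hv₀h
    omega
  obtain ⟨X, hX, hXmin⟩ := Finset.exists_min_image fam Finset.card ⟨U, hUfam⟩
  obtain ⟨hXU, hXt, v, hvX, hvs⟩ := (hfam X).1 hX
  have hproper : ∀ Y ⊂ X, Y ∉ fam := fun Y hY hYf =>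
    absurd (hXmin Y hYf) (not_le.2 (Finset.card_lt_card hY))
  obtain ⟨i, hiX, hiv⟩ := Finset.exists_mem_notMem_of_card_lt_card
    (show (rootColours R {v}).card < (rootColours R X).card from
      hvs.trans_le (min_le_right _ _))
  rw [mem_rootColours_singleton] at hiv
  let Y : Finset V := X.filter fun w => (i, w) ∉ R ∧ s {w} < h
  have hvY : v ∈ Y := Finset.mem_filter.2 ⟨hvX, hiv, hvs.trans_le (min_le_left _ _)⟩
  have hYX : Y ⊂ X := by
    refine (Finset.filter_subset _ _).ssubset_of_ne fun heq => ?_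
    obtain ⟨w, hw, hiw⟩ := mem_rootColours.1 hiX
    have heq : Y = X := heq
    rw [← heq] at hw
    exact (Finset.mem_filter.1 hw).2.1 hiw
  -- Otherwise every hyperarc entering `Y` also enters `X`; then `Y` belongs to `fam`, contrary to
  -- the minimality of `X`.
  have harc : ∃ a ∈ F, head a ∈ Y ∧ ¬ tails a ⊆ Y ∧ tails a ⊆ X := by
    by_contra! hno
    have hdle : d Y ≤ d X := by
      refine Finset.card_le_card fun a ha => ?_
      obtain ⟨haF, h1, h2⟩ := Finset.mem_filter.1 ha
      exact Finset.mem_filter.2 ⟨haF, hYX.subset h1, hno a haF h1 h2⟩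
    have h1 := hcov Y (hYX.subset.trans hXU) ⟨v, hvY⟩
    have h2 := smono hYX.subset
    exact hproper Y hYX ((hfam Y).2 ⟨hYX.subset.trans hXU, by omega, v, hvY, by omega⟩)
  obtain ⟨a, haF, haY, hatY, hatX⟩ := harc
  obtain ⟨u, hua, huY⟩ := Finset.not_subset.1 hatY
  have huX : u ∈ X := hatX hua
  obtain ⟨haX, hia, hah⟩ := Finset.mem_filter.1 haY
  -- A tail `u` in `X \ Y` has colour `i` or at least `h` colours, while `head a` lacks `i` and has
  -- fewer than `h`.
  obtain ⟨j, hju, hja⟩ : ∃ j, (j, u) ∈ R ∧ (j, head a) ∉ R := by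
    by_cases hiu : (i, u) ∈ R
    · exact ⟨i, hiu, hia⟩
    · have hsu : h ≤ s {u} := by
        by_contra hlt
        exact huY (Finset.mem_filter.2 ⟨huX, hiu, not_le.1 hlt⟩)
      obtain ⟨j, hj, hj'⟩ := Finset.exists_mem_notMem_of_card_lt_card
        (show (rootColours R {head a}).card < (rootColours R {u}).card from hah.trans_le hsu)
      exact ⟨j, mem_rootColours_singleton.1 hj, fun hc => hj' (mem_rootColours_singleton.2 hc)⟩
  refine ⟨a, haF, u, hua, j, hju, hja, hah, fun Z hZU hZne => ?_⟩
  have hZcov := hcov Z hZU hZne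
  have hmono := Finset.card_le_card
    (rootColours_mono (Finset.subset_insert (j, head a) R) (subset_refl Z))
  by_cases henter : head a ∈ Z ∧ ¬ tails a ⊆ Z
  swap
  · have : enterCount (F.erase a) head tails Z = d Z := by
      simp only [d, enterCount]
      rw [Finset.filter_erase, Finset.erase_eq_of_notMem]
      exact fun hc => henter (Finset.mem_filter.1 hc).2
    rw [this]
    exact hZcov.trans (Nat.add_le_add_left hmono _)
  have hdZ : enterCount (F.erase a) head tails Z + 1 = d Z := by
    simp only [d, enterCount]
    rw [Finset.filter_erase, Finset.card_erase_add_one (Finset.mem_filter.2 ⟨haF, henter⟩)]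
  obtain ⟨haZ, hatZ⟩ := henter
  by_cases hjZ : j ∈ rootColours R Z
  swap
  · rw [rootColours_insert_of_mem R j haZ, Finset.card_insert_of_notMem hjZ]
    change h ≤ d Z + (rootColours R Z).card at hZcov
    omega
  -- Only here is the lost hyperarc not offset by a new colour. If `Z` were tight, uncrossing with
  -- `X` would make `Z ∩ X` tight, and minimality of `X` would leave it only the colours of `head
  -- a`. Then `j` occurs in `Z` and in `X` but not in `Z ∩ X`, so submodularity of the colour count
  -- is strict, a contradiction.
  suffices hlt : h < d Z + s Z by
    change s Z ≤ _ at hmono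
    omega
  by_contra hnlt
  have haI : head a ∈ Z ∩ X := Finset.mem_inter.2 ⟨haZ, haX⟩
  have hIX : Z ∩ X ⊂ X := by
    refine Finset.inter_subset_right.ssubset_of_ne fun heq => hatZ ?_
    rw [Finset.inter_eq_right] at heq
    exact hatX.trans heq
  have e1 := enterCount_submodular F head tails Z X
  have e2 := hcov (Z ∩ X) (hIX.subset.trans hXU) ⟨_, haI⟩
  have e3 := hcov (Z ∪ X) (Finset.union_subset hZU hXU) ⟨_, Finset.mem_union_left _ haZ⟩
  have e4 := Finset.card_union_add_card_inter (rootColours R Z) (rootColours R X)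
  rw [← rootColours_union] at e4
  have e5 := Finset.card_le_card (rootColours_inter_subset R Z X)
  have e6 := smono (Finset.inter_subset_left (s₁ := Z) (s₂ := X))
  have e7 := smono (Finset.inter_subset_right (s₁ := Z) (s₂ := X))
  have e8 := smono (Finset.subset_union_right (s₁ := Z) (s₂ := X))
  have e9 := smono (Finset.subset_union_left (s₁ := Z) (s₂ := X))
  change d (Z ∪ X) + d (Z ∩ X) ≤ d Z + d X at e1
  change s (Z ∪ X) + _ = s Z + s X at e4
  change s (Z ∩ X) ≤ _ at e5
  have hIt : d (Z ∩ X) + min h (s (Z ∩ X)) = h := by omega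
  have hsa : s (Z ∩ X) ≤ s {head a} := by
    by_contra hlt
    exact hproper _ hIX ((hfam _).2
      ⟨hIX.subset.trans hXU, hIt, head a, haI, by omega⟩)
  have hcol : rootColours R {head a} = rootColours R (Z ∩ X) :=
    Finset.eq_of_subset_of_card_le
      (rootColours_mono subset_rfl (Finset.singleton_subset_iff.2 haI)) hsa
  have hjI : j ∉ rootColours R (Z ∩ X) := by
    rw [← hcol, mem_rootColours_singleton]
    exact hja
  have hjZX : j ∈ rootColours R Z ∩ rootColours R X :=
    Finset.mem_inter.2 ⟨hjZ, mem_rootColours.2 ⟨u, huX, hju⟩⟩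
  have e10 : s (Z ∩ X) < (rootColours R Z ∩ rootColours R X).card :=
    Finset.card_lt_card ((Finset.ssubset_iff_of_subset (rootColours_inter_subset R Z X)).2
      ⟨j, hjZX, hjI⟩)
  have e11 : (rootColours R Z ∩ rootColours R X).card ≤ s Z :=
    Finset.card_le_card Finset.inter_subset_left
  omega

/-- A packing of hyperbranchings with given roots in which every vertex lies in exactly `h` cores
exists if every set is entered by as many hyperarcs as it misses colours. -/
theorem exists_regular_packing [DecidableEq ε] {U : Finset V} {head : ε → V}
    {tails : ε → Finset V} {h : ℕ} (F : Finset ε) (R : Finset (K × V))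
    (hhead : ∀ a ∈ F, head a ∈ U) (htails : ∀ a ∈ F, tails a ⊆ U)
    (hR : ∀ i v, (i, v) ∈ R → v ∈ U) (hr : ∀ v ∈ U, (rootColours R {v}).card ≤ h)
    (hcov : ∀ X ⊆ U, X.Nonempty → h ≤ enterCount F head tails X + (rootColours R X).card) :
    ∃ (B : K → Finset ε) (tail : ε → V), (∀ i, B i ⊆ F) ∧
      (∀ i j, i ≠ j → Disjoint (B i) (B j)) ∧
      (∀ i, ∀ a ∈ B i, tail a ∈ tails a ∧ tail a ∈ (B i).image head ∪ rootSet R i ∧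
        (i, head a) ∉ R) ∧
      (∀ i, Set.InjOn head (B i)) ∧
      (∀ i, ∀ v ∈ (B i).image head ∪ rootSet R i,
        ∃ p, IsDipathTo (rootSet R i) (B i) tail head v p) ∧
      ∀ v ∈ U, (Finset.univ.filter fun i => v ∈ (B i).image head ∪ rootSet R i).card = h := by
  induction F using Finset.strongInduction generalizing R with
  | _ F ih =>
  by_cases hlow : ∃ v ∈ U, (rootColours R {v}).card < h
  swap
  · push Not at hlow
    refine ⟨fun _ => ∅, head, by simp, by simp, by simp, by simp, ?_, ?_⟩
    · intro i v hv
      exact ⟨[], show v ∈ rootSet R i by simpa using hv⟩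
    · intro v hv
      rw [← (hr v hv).antisymm (hlow v hv)]
      congr 1
      ext i
      simp [mem_rootSet, mem_rootColours_singleton]
  obtain ⟨a, haF, u, hua, j, hju, hja, hah, hcov'⟩ := exists_replaceable_arc htails hcov hlow
  obtain ⟨B, tail, hBF, hBd, hBt, hBi, hBp, hBh⟩ := ih (F.erase a) (Finset.erase_ssubset haF)
    (insert (j, head a) R) (fun b hb => hhead b (Finset.mem_of_mem_erase hb))
    (fun b hb => htails b (Finset.mem_of_mem_erase hb))
    (by
      intro i v hiv
      rcases Finset.mem_insert.1 hiv with heq | hiv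
      · rw [Prod.mk.injEq] at heq
        rw [heq.2]
        exact hhead a haF
      · exact hR i v hiv)
    (by
      intro v hv
      by_cases hva : v = head a
      · rw [rootColours_insert_of_mem R j (by simp [hva]), hva]
        exact (Finset.card_insert_le _ _).trans hah
      · rw [rootColours_insert_of_notMem R j (by simpa using Ne.symm hva)]
        exact hr v hv)
    hcov'
  have haB : ∀ i, a ∉ B i := fun i hai => Finset.notMem_erase a F (hBF i hai)
  have hne : ∀ i, ∀ b ∈ B i, b ≠ a := fun i b hb hba => haB i (hba ▸ hb)
  -- The temporary root `(j, head a)` becomes the head of `a`, now an arc of `B' j` leaving the root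
  -- `u` of the same colour; the cores do not change.
  let B' : K → Finset ε := Function.update B j (insert a (B j))
  let tail' : ε → V := Function.update tail a u
  have hBj : B' j = insert a (B j) := Function.update_self ..
  have hBo : ∀ i, i ≠ j → B' i = B i := fun i hi => Function.update_of_ne hi ..
  have hBB' : ∀ i, B i ⊆ B' i := by
    intro i
    by_cases hi : i = j
    · subst hi
      rw [hBj]
      exact Finset.subset_insert _ _
    · rw [hBo i hi]
  have hta : tail' a = u := Function.update_self ..
  have hto : ∀ b, b ≠ a → tail' b = tail b := fun b hb => Function.update_of_ne hb ..
  have hcore : ∀ i, (B' i).image head ∪ rootSet R i =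
      (B i).image head ∪ rootSet (insert (j, head a) R) i := by
    intro i
    ext v
    by_cases hi : i = j
    · subst hi
      simp only [hBj, Finset.mem_union, Finset.image_insert, Finset.mem_insert, mem_rootSet,
        Prod.mk.injEq, true_and]
      tauto
    · simp [hBo i hi, mem_rootSet, hi]
  have hmem : ∀ i, ∀ b ∈ B' i, b ∈ B i ∨ (i = j ∧ b = a) := by
    intro i b hb
    by_cases hi : i = j
    · subst hi
      rw [hBj, Finset.mem_insert] at hb
      tauto
    · rw [hBo i hi] at hb
      exact Or.inl hb
  refine ⟨B', tail', ?_, ?_, ?_, ?_, ?_, ?_⟩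
  · intro i b hb
    rcases hmem i b hb with hb | ⟨-, rfl⟩
    · exact Finset.mem_of_mem_erase (hBF i hb)
    · exact haF
  · intro i i' hii'
    rw [Finset.disjoint_left]
    intro b hb hb'
    rcases hmem i b hb with h₁ | ⟨h₁, h₁'⟩ <;> rcases hmem i' b hb' with h₂ | ⟨h₂, h₂'⟩
    · exact Finset.disjoint_left.1 (hBd i i' hii') h₁ h₂
    · exact hne i b h₁ h₂'
    · exact hne i' b h₂ h₁'
    · exact hii' (h₁.trans h₂.symm)
  · intro i b hb
    rw [hcore]
    rcases hmem i b hb with hb | ⟨rfl, rfl⟩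
    · rw [hto b (hne i b hb)]
      obtain ⟨h1, h2, h3⟩ := hBt i b hb
      exact ⟨h1, h2, fun hc => h3 (Finset.mem_insert_of_mem hc)⟩
    · rw [hta]
      exact ⟨hua, Finset.mem_union_right _ (mem_rootSet.2 (Finset.mem_insert_of_mem hju)), hja⟩
  · intro i b hb c hc hbc
    rcases hmem i b hb with h₁ | ⟨h₁, h₁'⟩ <;> rcases hmem i c hc with h₂ | ⟨h₂, h₂'⟩
    · exact hBi i h₁ h₂ hbc
    · exact absurd (Finset.mem_insert.2 (Or.inl (by rw [hbc, h₂, h₂']))) (hBt i b h₁).2.2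
    · exact absurd (Finset.mem_insert.2 (Or.inl (by rw [← hbc, h₁, h₁']))) (hBt i c h₂).2.2
    · exact h₁'.trans h₂'.symm
  · intro i v hv
    rw [hcore] at hv
    obtain ⟨p, hp⟩ := hBp i v hv
    refine hp.transfer (fun b hb => ⟨hBB' i hb, hto b (hne i b hb)⟩) fun w hw => ?_
    rcases Finset.mem_insert.1 (mem_rootSet.1 hw) with heq | hw
    · rw [Prod.mk.injEq] at heq
      obtain ⟨rfl, rfl⟩ := heq
      refine ⟨[a], by simp [hBj], rfl, ?_⟩
      rw [hta]
      exact mem_rootSet.2 hju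
    · exact ⟨[], mem_rootSet.2 hw⟩
  · intro v hv
    rw [← hBh v hv]
    simp only [hcore]

end Packing

/-! ### Sizes of the root sets. -/

section Sizes

variable {K : Type*} [Fintype K]

/-- Water filling: numbers `n i` between `l i` and `l' i` with a prescribed sum, as equal as
possible. -/
theorem exists_level_sizes {l l' : K → ℕ} (hl : ∀ i, l i ≤ l' i) (T : ℕ)
    (hT : ∑ i, l i ≤ T) (hT' : T ≤ ∑ i, l' i) :
    ∃ (n : K → ℕ) (τ : ℕ), (∀ i, l i ≤ n i ∧ n i ≤ l' i) ∧ ∑ i, n i = T ∧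
      ∀ i, min (l' i) τ ≤ n i ∧ n i ≤ max (l i) (τ + 1) := by
  classical
  induction T, hT using Nat.le_induction with
  | base => exact ⟨l, 0, fun i => ⟨le_rfl, hl i⟩, rfl, fun i => ⟨by simp, le_max_left _ _⟩⟩
  | succ T hT ih =>
    obtain ⟨n, τ, h1, h2, h3⟩ := ih (by omega)
    have hne : (Finset.univ.filter fun i => n i < l' i).Nonempty := by
      by_contra hno
      rw [Finset.not_nonempty_iff_eq_empty, Finset.filter_eq_empty_iff] at hno
      have : ∑ i, l' i ≤ ∑ i, n i :=
        Finset.sum_le_sum fun i hi => not_lt.1 (hno hi)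
      omega
    obtain ⟨i, hi, hmin⟩ := Finset.exists_min_image _ n hne
    simp only [Finset.mem_filter, Finset.mem_univ, true_and] at hi hmin
    have hτ : τ ≤ n i := by
      have := (h3 i).1
      omega
    -- The least value among the numbers that can still grow becomes the new level.
    refine ⟨Function.update n i (n i + 1), n i, fun j => ?_, ?_, fun j => ?_⟩
    · by_cases hj : j = i
      · subst hj
        have := h1 j
        simp only [Function.update_self]
        omega
      · simpa only [Function.update_of_ne hj] using h1 j
    · rw [Finset.sum_update_of_mem (Finset.mem_univ i), ← h2,
        ← Finset.add_sum_erase _ _ (Finset.mem_univ i), Finset.sdiff_singleton_eq_erase]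
      omega
    · by_cases hj : j = i
      · subst hj
        simp only [Function.update_self]
        omega
      · simp only [Function.update_of_ne hj]
        have e1 := h3 j
        have e2 := h1 j
        have e3 := hmin j
        omega

/-- If at most `h` of the `l i` exceed `t`, each contributes at most `N - t`; otherwise `t` is
subtracted at least `h` times from a sum of at most `h * N`. -/
theorem sum_tsub_le {l : K → ℕ} {h N t : ℕ} (hl : ∀ i, l i ≤ N)
    (hsum : ∑ i, l i ≤ h * N) : ∑ i, (l i - t) ≤ h * (N - t) := by
  let I : Finset K := Finset.univ.filter fun i => t < l i
  have hI : ∑ i, (l i - t) = ∑ i ∈ I, (l i - t) := by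
    rw [Finset.sum_filter]
    refine Finset.sum_congr rfl fun i _ => ?_
    split_ifs <;> omega
  rw [hI]
  rcases le_total I.card h with hle | hle
  · calc ∑ i ∈ I, (l i - t) ≤ I.card * (N - t) := by
          rw [← smul_eq_mul]
          exact Finset.sum_le_card_nsmul _ _ _ fun i _ => Nat.sub_le_sub_right (hl i) t
      _ ≤ h * (N - t) := Nat.mul_le_mul_right _ hle
  · have h1 : ∑ i ∈ I, (l i - t) + I.card * t = ∑ i ∈ I, l i := by
      rw [← smul_eq_mul, ← Finset.sum_const, ← Finset.sum_add_distrib]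
      refine Finset.sum_congr rfl fun i hi => ?_
      have := (Finset.mem_filter.1 hi).2
      omega
    have h2 : ∑ i ∈ I, l i ≤ ∑ i, l i :=
      Finset.sum_le_sum_of_subset (Finset.subset_univ _)
    have h3 : h * t ≤ I.card * t := Nat.mul_le_mul_right _ hle
    rw [Nat.mul_sub]
    omega

/-- Sizes of the root sets that satisfy all bounds and the partition condition. The relation
`c t e` stands for the existence of a partition into `t` classes crossed by `e` hyperedges. -/
theorem exists_sizes {l l' : K → ℕ} {h N L L' : ℕ} {c : ℕ → ℕ → Prop}
    (hl : ∀ i, l i ≤ l' i) (hN : ∀ i, l' i ≤ N) (hL' : L' ≤ ∑ i, l' i) (hLL' : L ≤ L')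
    (hL : ∑ i, l i ≤ L) (hLN : L ≤ h * N) (hc : ∀ t e, c t e → t ≤ N)
    (h1 : ∀ t e, c t e →
      (h : ℤ) * t ≤ (L' : ℤ) - ∑ i, (l i : ℤ) + ∑ i, ((min (l i) t : ℕ) : ℤ) + e)
    (h2 : ∀ t e, c t e → h * t ≤ ∑ i, min (l' i) t + e) :
    ∃ n : K → ℕ, (∀ i, l i ≤ n i ∧ n i ≤ l' i) ∧ L ≤ ∑ i, n i ∧ ∑ i, n i ≤ L' ∧
      ∑ i, n i ≤ h * N ∧ ∀ t e, c t e → h * t ≤ ∑ i, min (n i) t + e := by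
  obtain ⟨n, τ, hn, hsum, hτ⟩ := exists_level_sizes hl (min L' (h * N)) (by omega) (by omega)
  refine ⟨n, hn, by omega, by omega, by omega, fun t e hte => ?_⟩
  -- Up to the level, `min (n i) t` is at least `min (l' i) t` and `h2` applies. Above it, `n i` and
  -- `l i` have the same excess over `t`; then `h1` settles the total `L'`, and `sum_tsub_le` the
  -- total `h * N`, even without hyperedges.
  rcases le_or_gt t τ with ht | ht
  · refine (h2 t e hte).trans (Nat.add_le_add_right (Finset.sum_le_sum fun i _ => ?_) _)
    have := hτ i
    omega
  · have hmin : ∑ i, min (n i) t + ∑ i, l i = ∑ i, min (l i) t + ∑ i, n i := by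
      rw [← Finset.sum_add_distrib, ← Finset.sum_add_distrib]
      refine Finset.sum_congr rfl fun i _ => ?_
      have e1 := hτ i
      have e2 := hn i
      omega
    rcases le_total L' (h * N) with hle | hle
    · have e1 := h1 t e hte
      rw [min_eq_left hle] at hsum
      have e2 : ((∑ i, min (n i) t : ℕ) : ℤ) + (∑ i, l i : ℕ) =
          (∑ i, min (l i) t : ℕ) + (∑ i, n i : ℕ) := by exact_mod_cast hmin
      rw [← Nat.cast_sum, ← Nat.cast_sum] at e1
      rw [hsum] at e2
      have e3 : (h : ℤ) * t ≤ (∑ i, min (n i) t : ℕ) + e := by linarith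
      exact_mod_cast e3
    · rw [min_eq_right hle] at hsum
      have e1 := sum_tsub_le (t := t) (fun i => (hl i).trans (hN i)) (hL.trans hLN)
      have e2 : ∑ i, (l i - t) + ∑ i, min (l i) t = ∑ i, l i := by
        rw [← Finset.sum_add_distrib]
        exact Finset.sum_congr rfl fun i _ => by omega
      have e3 : h * (N - t) + h * t = h * N := by
        rw [← Nat.mul_add, Nat.sub_add_cancel (hc t e hte)]
      omega

end Sizes

/-! ### Directed paths in branchings. -/

section Branching

variable {V ε : Type*}

/-- Traced backwards, a path has no choice: each vertex has at most one entering arc, and a root has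
none. -/
theorem IsDipathTo.unique {S : Finset V} {A : Finset ε} {tail head : ε → V}
    (hS : ∀ a ∈ A, head a ∉ S) (hinj : Set.InjOn head A) {v : V} {p p' : List ε}
    (hp : IsDipathTo S A tail head v p) (hp' : IsDipathTo S A tail head v p') : p = p' := by
  induction p generalizing v p' with
  | nil =>
    cases p' with
    | nil => rfl
    | cons b p' => exact absurd (hp'.2.1 ▸ hp) (hS b hp'.1)
  | cons a p ih =>
    cases p' with
    | nil => exact absurd (hp.2.1 ▸ hp') (hS a hp.1)
    | cons b p' =>
      obtain rfl : a = b := hinj hp.1 hp'.1 (hp.2.1.trans hp'.2.1.symm)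
      rw [ih hp.2.2 hp'.2.2]

theorem IsDipathTo.exists_entering {S : Finset V} {A : Finset ε} {tail head : ε → V}
    {X : Finset V} (hS : ∀ v ∈ S, v ∉ X) {v : V} {p : List ε}
    (hp : IsDipathTo S A tail head v p) (hv : v ∈ X) : ∃ a ∈ A, head a ∈ X ∧ tail a ∉ X := by
  induction p generalizing v with
  | nil => exact absurd hv (hS v hp)
  | cons a p ih =>
    obtain ⟨ha, rfl, hp⟩ := hp
    by_cases ht : tail a ∈ X
    · exact ih hp ht
    · exact ⟨a, ha, hv, ht⟩

end Branching

/-! ### Necessity, and the packing for fixed sizes. -/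

namespace FinHypergraph

variable {V ε : Type*} [DecidableEq V] {G : FinHypergraph V ε} {h k : ℕ}
  {B : Fin k → FinHypergraph V ε} {S : Fin k → Finset V}

theorem IsRegularPacking.roots_subset (hp : G.IsRegularPacking h B S) (i : Fin k) :
    S i ⊆ G.verts := by
  obtain ⟨D, ⟨hv, -, -⟩, hD⟩ := hp.hyperforest i
  exact hD.1.trans (hv ▸ (hp.sub i).1)

theorem IsRegularPacking.sum_card_roots_le (hp : G.IsRegularPacking h B S) :
    ∑ i, (S i).card ≤ h * G.verts.card := by
  obtain ⟨D, -, hreg⟩ := hp.regular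
  have h1 := Finset.sum_card_bipartiteAbove_eq_sum_card_bipartiteBelow
    (s := G.verts) (t := (Finset.univ : Finset (Fin k))) fun v i => v ∈ (D i).core (S i)
  have h2 : ∑ v ∈ G.verts, (Finset.bipartiteAbove (fun v i => v ∈ (D i).core (S i))
      (Finset.univ : Finset (Fin k)) v).card = h * G.verts.card := by
    refine (Finset.sum_congr rfl fun v hv => hreg v hv).trans ?_
    rw [Finset.sum_const, smul_eq_mul, mul_comm]
  rw [← h2, h1]
  refine Finset.sum_le_sum fun i _ => Finset.card_le_card fun v hv => ?_
  exact Finset.mem_filter.2 ⟨hp.roots_subset i hv, Finset.mem_union_right _ hv⟩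

theorem IsRegularPacking.le_crossing (hp : G.IsRegularPacking h B S) (P : Finpartition G.verts) :
    h * P.parts.card ≤ ∑ i, min (S i).card P.parts.card + G.crossing P := by
  classical
  obtain ⟨D, hD, hreg⟩ := hp.regular
  let meets : Finset V → Fin k → Prop := fun X i => (S i ∩ X).Nonempty
  let enters : Finset V → Fin k → ε → Prop := fun X i e =>
    e ∈ (B i).edges ∧ (D i).head e ∈ X ∧ ¬ G.ends e ⊆ X
  have hX : ∀ X ∈ P.parts, h ≤ (Finset.univ.filter fun i => meets X i).card +
      (Finset.univ.filter fun i => ∃ e, enters X i e).card := by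
    intro X hX
    obtain ⟨v, hv⟩ := P.nonempty_of_mem_parts hX
    rw [← hreg v (P.le hX hv)]
    refine (Finset.card_le_card fun i hi => ?_).trans (Finset.card_union_le _ _)
    simp only [Finset.mem_union, Finset.mem_filter, Finset.mem_univ, true_and] at hi ⊢
    by_cases hm : meets X i
    · exact Or.inl hm
    right
    obtain ⟨⟨-, harcs, hor⟩, -, tail, htail, -, -, hpath⟩ := hD i
    obtain ⟨p, hpv, -⟩ := hpath v hi
    obtain ⟨e, he, heX, htX⟩ := hpv.exists_entering
      (fun w hw hwX => hm ⟨w, Finset.mem_inter.2 ⟨hw, hwX⟩⟩) hv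
    have ht := htail e he
    rw [harcs] at he
    refine ⟨e, he, heX, fun hsub => htX (hsub ?_)⟩
    rw [(hor e he).2, (hp.sub i).2.2 e he] at ht
    exact Finset.mem_of_mem_erase ht
  have hmeets : ∑ X ∈ P.parts, (Finset.univ.filter fun i => meets X i).card ≤
      ∑ i, min (S i).card P.parts.card := by
    have := Finset.sum_card_bipartiteAbove_eq_sum_card_bipartiteBelow
      (s := P.parts) (t := (Finset.univ : Finset (Fin k))) meets
    refine this.le.trans (Finset.sum_le_sum fun i _ => le_min ?_ ?_)
    · refine Finset.card_le_card_of_forall_subsingleton (fun X v => v ∈ X) ?_ ?_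
      · intro X hX
        obtain ⟨v, hv⟩ := (Finset.mem_filter.1 hX).2
        rw [Finset.mem_inter] at hv
        exact ⟨v, hv.1, hv.2⟩
      · rintro v - X ⟨hX, hvX⟩ Y ⟨hY, hvY⟩
        exact P.eq_of_mem_parts (Finset.mem_filter.1 hX).1 (Finset.mem_filter.1 hY).1 hvX hvY
    · exact Finset.card_le_card (Finset.filter_subset _ _)
  have henters : ∑ X ∈ P.parts, (Finset.univ.filter fun i => ∃ e, enters X i e).card ≤
      G.crossing P := by
    -- A pair of a class and an index is assigned a hyperedge that determines it: its head fixes the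
    -- class, and disjointness of the `B i` fixes the index.
    rw [← Finset.card_sigma]
    refine Finset.card_le_card_of_forall_subsingleton
      (fun (a : Σ _ : Finset V, Fin k) e => enters a.1 a.2 e) ?_ ?_
    · rintro ⟨X, i⟩ ha
      simp only [Finset.mem_sigma, Finset.mem_filter, Finset.mem_univ, true_and] at ha
      obtain ⟨hX, e, he, heX, hsub⟩ := ha
      refine ⟨e, Finset.mem_filter.2 ⟨(hp.sub i).2.1 he, X, hX, ⟨(D i).head e, ?_⟩,
        Finset.sdiff_nonempty.2 hsub⟩, he, heX, hsub⟩
      rw [Finset.mem_inter, ← (hp.sub i).2.2 e he]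
      exact ⟨((hD i).1.2.2 e he).1, heX⟩
    · rintro e - ⟨X, i⟩ ⟨ha, he, heX, -⟩ ⟨Y, j⟩ ⟨hb, he', heY, -⟩
      obtain rfl : i = j := by
        by_contra hij
        exact Finset.disjoint_left.1 (hp.disjoint i j hij) he he'
      obtain rfl : X = Y :=
        P.eq_of_mem_parts (Finset.mem_sigma.1 ha).1 (Finset.mem_sigma.1 hb).1 heX heY
      rfl
  have hsum := Finset.sum_le_sum hX
  rw [Finset.sum_const, smul_eq_mul, Finset.sum_add_distrib, mul_comm] at hsum
  omega

/-- The subhypergraph with hyperedge set `F`. -/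
def restrictEdges (G : FinHypergraph V ε) (F : Finset ε) (hF : F ⊆ G.edges) :
    FinHypergraph V ε where
  verts := G.verts
  edges := F
  ends := G.ends
  ends_subset e he := G.ends_subset e (hF he)
  two_le_card e he := G.two_le_card e (hF he)

/-- The orientation of the subhypergraph with hyperedge set `F` that has the given heads. -/
def orientEdges (G : FinHypergraph V ε) (F : Finset ε) (hF : F ⊆ G.edges) (head : ε → V)
    (hhead : ∀ e ∈ G.edges, head e ∈ G.ends e) : FinDypergraph V ε where
  verts := G.verts
  arcs := F
  head := head
  tails e := (G.ends e).erase (head e)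
  head_mem e he := G.ends_subset e (hF he) (hhead e (hF he))
  tails_subset e he := (Finset.erase_subset _ _).trans (G.ends_subset e (hF he))
  tails_nonempty e he := by
    rw [← Finset.card_pos, Finset.card_erase_of_mem (hhead e (hF he))]
    have := G.two_le_card e (hF he)
    omega
  head_notMem_tails e _ := Finset.notMem_erase _ _

theorem exists_isRegularPacking (G : FinHypergraph V ε) (h : ℕ) {k : ℕ} (hne : G.verts.Nonempty)
    (n : Fin k → ℕ) (hn : ∀ i, n i ≤ G.verts.card) (hsum : ∑ i, n i ≤ h * G.verts.card)
    (hP : ∀ P : Finpartition G.verts,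
      h * P.parts.card ≤ ∑ i, min (n i) P.parts.card + G.crossing P) :
    ∃ (B : Fin k → FinHypergraph V ε) (S : Fin k → Finset V),
      G.IsRegularPacking h B S ∧ ∀ i, (S i).card = n i := by
  classical
  obtain ⟨R₀, hU₀, hn₀, hD₀⟩ := G.exists_roots h hne n hP
  obtain ⟨head, hhead, hcov₀⟩ := G.exists_heads h R₀ hne hD₀
  obtain ⟨R, hU, hRn, hcov, hr⟩ := exists_exact_roots R₀ hU₀
    (fun i => Finset.card_image_le.trans (hn₀ i)) hn hsum hcov₀
  obtain ⟨F, tail, hF, hdisj, htail, hinj, hpath, hreg⟩ := exists_regular_packing G.edges R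
    (fun e he => G.ends_subset e he (hhead e he))
    (fun e he => (Finset.erase_subset _ _).trans (G.ends_subset e he)) hU hr hcov
  have horient : ∀ i, (G.restrictEdges (F i) (hF i)).IsOrientation
      (G.orientEdges (F i) (hF i) head hhead) := fun i =>
    ⟨rfl, rfl, fun e he => ⟨hhead e (hF i he), rfl⟩⟩
  have hbranch : ∀ i, (G.orientEdges (F i) (hF i) head hhead).IsHyperbranching (rootSet R i) := by
    refine fun i => ⟨fun v hv => hU i v (mem_rootSet.1 hv), tail,
      fun e he => (htail i e he).1, Finset.subset_union_right, fun e he =>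
        ⟨(htail i e he).2.1, Finset.mem_union_left _ (Finset.mem_image_of_mem _ he)⟩,
      fun v hv => ?_⟩
    obtain ⟨p, hp⟩ := hpath i v hv
    exact ⟨p, hp, fun p' hp' => hp'.unique
      (fun e he hS => (htail i e he).2.2 (mem_rootSet.1 hS)) (hinj i) hp⟩
  exact ⟨fun i => G.restrictEdges (F i) (hF i), rootSet R,
    { sub := fun i => ⟨subset_rfl, hF i, fun _ _ => rfl⟩
      disjoint := hdisj
      hyperforest := fun i => ⟨_, horient i, hbranch i⟩
      regular := ⟨fun i => G.orientEdges (F i) (hF i) head hhead,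
        fun i => ⟨horient i, hbranch i⟩, fun v hv => hreg v hv⟩ }, hRn⟩

end FinHypergraph

/-- The functions `ℓ`, `ℓ'` are defined on `{0, 1, …, k}`; `i.succ` for `i : Fin k` runs through
`1, …, k`. -/
theorem mainTheorem1 {V ε : Type*} [DecidableEq V]
    (G : FinHypergraph V ε) (h k : ℕ) (hh : 0 < h) (hk : 0 < k)
    (ℓ ℓ' : Fin (k + 1) → ℕ) (hℓ : ∀ i, 0 < ℓ i) (hℓ' : ∀ i, 0 < ℓ' i)
    (h_total : ℓ' 0 ≤ ∑ i : Fin k, ℓ' i.succ ∧ ℓ 0 ≤ ℓ' 0 ∧ ∑ i : Fin k, ℓ i.succ ≤ ℓ 0)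
    (h_each : ∀ i : Fin k, ℓ' i.succ ≤ G.verts.card ∧ ℓ i.succ ≤ ℓ' i.succ) :
    (∃ (B : Fin k → FinHypergraph V ε) (S : Fin k → Finset V),
        G.IsRegularPacking h B S ∧
        (∀ i : Fin k, ℓ i.succ ≤ (S i).card ∧ (S i).card ≤ ℓ' i.succ) ∧
        ℓ 0 ≤ ∑ i : Fin k, (S i).card ∧ ∑ i : Fin k, (S i).card ≤ ℓ' 0) ↔
      (ℓ 0 ≤ h * G.verts.card ∧
        (∀ P : Finpartition G.verts,
          (h : ℤ) * P.parts.card ≤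
            (ℓ' 0 : ℤ) - (∑ i : Fin k, (ℓ i.succ : ℤ)) +
              (∑ i : Fin k, ((min (ℓ i.succ) P.parts.card : ℕ) : ℤ)) + G.crossing P) ∧
        (∀ P : Finpartition G.verts,
          h * P.parts.card ≤
            (∑ i : Fin k, min (ℓ' i.succ) P.parts.card) + G.crossing P)) := by
  constructor
  · rintro ⟨B, S, hp, hS, hlow, hupp⟩
    refine ⟨hlow.trans hp.sum_card_roots_le, fun P => ?_, fun P => ?_⟩
    · have h1 := hp.le_crossing P
      -- Raising a number from `ℓ i.succ` to `(S i).card` raises its minimum with `|P|` by no more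
      -- than the increase.
      have h2 : ∑ i, min (S i).card P.parts.card + ∑ i : Fin k, ℓ i.succ ≤
          ∑ i : Fin k, min (ℓ i.succ) P.parts.card + ∑ i, (S i).card := by
        rw [← Finset.sum_add_distrib, ← Finset.sum_add_distrib]
        refine Finset.sum_le_sum fun i _ => ?_
        have := hS i
        omega
      have h3 : h * P.parts.card + ∑ i : Fin k, ℓ i.succ ≤
          ℓ' 0 + ∑ i : Fin k, min (ℓ i.succ) P.parts.card + G.crossing P := by omega
      rw [← Nat.cast_sum, ← Nat.cast_sum]
      zify at h3
      push_cast at h3 ⊢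
      linarith
    · refine (hp.le_crossing P).trans (Nat.add_le_add_right (Finset.sum_le_sum fun i _ => ?_) _)
      exact min_le_min_right _ (hS i).2
  · rintro ⟨h0, h1, h2⟩
    have hne : G.verts.Nonempty :=
      Finset.card_pos.1 ((hℓ' _).trans_le (h_each ⟨0, hk⟩).1)
    obtain ⟨n, hn, hlow, hupp, hnV, hnP⟩ := exists_sizes (l := fun i : Fin k => ℓ i.succ)
      (l' := fun i : Fin k => ℓ' i.succ) (h := h) (N := G.verts.card)
      (c := fun t e => ∃ P : Finpartition G.verts, P.parts.card = t ∧ G.crossing P = e)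
      (fun i => (h_each i).2) (fun i => (h_each i).1) h_total.1 h_total.2.1 h_total.2.2 h0
      (by rintro t e ⟨P, rfl, rfl⟩; exact P.card_parts_le_card)
      (by rintro t e ⟨P, rfl, rfl⟩; exact h1 P)
      (by rintro t e ⟨P, rfl, rfl⟩; exact h2 P)
    obtain ⟨B, S, hp, hS⟩ := G.exists_isRegularPacking h hne n
      (fun i => (hn i).2.trans (h_each i).1) hnV fun P => hnP _ _ ⟨P, rfl, rfl⟩
    simp only [← hS] at hn hlow hupp
    exact ⟨B, S, hp, hn, hlow, hupp⟩
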